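/- \textbf{Noisy convolutional fidelity.} Let $q\ge 2$ and let $\Phi(\rho)=\sum_k E_k\rho E_k^\dagger$ be a single-qudit channel on $\mathbb C^q$ ($\sum_k E_k^\dagger E_k=I$, finitely many Kraus operators). Let $U_1,\dots,U_{n-1}$ ($n\ge 2$) be independent Haar-random unitaries in $U(q^2)$, where $U_j$ acts on the qudits $j,j+1$ of an $n$-qudit register initially in the state $|0\cdots0\rangle$. Apply the convolutional circuit $U_1,U_2,\dots,U_{n-1}$ (in this order) and then the rewinding circuit, i.e. the inverses $U_{n-2}^\dagger,\dots,U_2^\dagger,U_1^\dagger$ of the gates that do not touch the last qudit. Every gate, including those of the rewinding circuit, is followed by $\Phi\otimes\Phi$ on the two qudits it acts on, except that when qudit $i$ is read out, it is read out directly at the output of the last gate acting on it (the noise on qudit $i$ immediately before the read-out is not included). Let $\rho$ be the resulting state, and let $\mathcal F_i=\mathcal F_i^{(n)}$ be the average over the gates of $\mathrm{Tr}\big[(|0\rangle\langle 0|_i\otimes I)\rho\big]$, which is an integrable function of the gates. Put $$\alpha=\frac{1}{q^2}\sum_k|\mathrm{Tr}\,E_k|^2,\qquad \beta=\frac1{q^2}\sum_{k,k'}|\mathrm{Tr}(E_kE_{k'})|^2,$$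 $$D=(1-\alpha\beta)q^4+\alpha q^2-1,\qquad \mathcal F_\infty=\frac{(1-\alpha\beta)q^3+\alpha q^2-1}{D},\qquad \lambda=\frac{\alpha q^2(\beta q^2-1)}{q^4-1}.$$ Then $\alpha$ is the entanglement fidelity $\langle\varphi|(\mathrm{id}\otimes\Phi)(|\varphi\rangle\langle\varphi|)|\varphi\rangle$ of $\Phi$, where $\varphi=q^{-1/2}\sum_k|k\rangle|k\rangle$; $D>0$ and $|\lambda|<1$; and 1. for every $n\ge2$, $$\mathcal F_1=\frac{(1-\alpha\beta)q^3+(\alpha q^2-1)\left(1-\frac{q-1}{q}\lambda^{n-2}\right)}{D};$$ 2. for all $1<i<n$, $$\mathcal F_i=\mathcal F_\infty-\frac{\alpha q(\alpha q^2-1)(\beta q^2-1)}{(1+q)(1+q^2)D}\,\lambda^{n-i-1};$$ 3. for every fixed $i\ge1$, $\mathcal F_i^{(n)}\to\mathcal F_\infty$ as $n\to\infty$, geometrically with ratio $\lambda$: $\mathcal F_i^{(n+1)}-\mathcal F_\infty=\lambda\,(\mathcal F_i^{(n)}-\mathcal F_\infty)$ for all $n>i$. If moreover $\alpha q^2\ge1$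 and $\beta q^2\ge1$, then $\sup_{n>i}\mathcal F_i^{(n)}=\mathcal F_\infty$. -/

import Mathlib

open MeasureTheory Filter Topology
open scoped Matrix Kronecker

noncomputable section

/-! ### Haar-random two-qudit gates -/

/-- The group `U(q²)` of unitary gates on two qudits of local dimension `q`. -/
abbrev TwoQuditUnitary (q : ℕ) := Matrix.unitaryGroup (Fin q × Fin q) ℂ

instance TwoQuditUnitary.compactSpace (q : ℕ) : CompactSpace (TwoQuditUnitary q) := by
  have hK : IsCompact (Set.univ.pi fun _ : Fin q × Fin q =>
      Set.univ.pi fun _ : Fin q × Fin q => Metric.closedBall (0 : ℂ) 1) :=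
    isCompact_univ_pi fun _ => isCompact_univ_pi fun _ => isCompact_closedBall _ _
  have hc : IsClosed (unitary (Matrix (Fin q × Fin q) (Fin q × Fin q) ℂ) :
      Set (Matrix (Fin q × Fin q) (Fin q × Fin q) ℂ)) := isClosed_unitary
  refine isCompact_iff_compactSpace.mp (hK.of_isClosed_subset hc ?_)
  intro U hU i _ j _
  simpa using entry_norm_bound_of_unitary hU i j

instance TwoQuditUnitary.measurableSpace (q : ℕ) : MeasurableSpace (TwoQuditUnitary q) :=
  borel _

instance TwoQuditUnitary.borelSpace (q : ℕ) : BorelSpace (TwoQuditUnitary q) := ⟨rfl⟩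

/-- The Haar measure on `U(q²)`, normalised to total mass one. -/
def haarUnitary (q : ℕ) : Measure (TwoQuditUnitary q) :=
  Measure.haarMeasure ⊤

/-! ### Operators on `n` qudits, indexed by the computational basis `Fin n → Fin q` -/

/-- Operators on the Hilbert space of `n` qudits. -/
abbrev QuditOp (q n : ℕ) := Matrix (Fin n → Fin q) (Fin n → Fin q) ℂ

/-- The operator acting as `A` on qudit `a` and as the identity on all other qudits. -/
def onSite {q n : ℕ} (a : Fin n) (A : Matrix (Fin q) (Fin q) ℂ) : QuditOp q n :=
  fun x y => if ∀ k, k ≠ a → x k = y k then A (x a) (y a) else 0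

/-- The operator acting as `V` on the qudits `a`, `b` (in this order, `a ≠ b`) and as the identity
on all other qudits. -/
def onPair {q n : ℕ} (a b : Fin n) (V : Matrix (Fin q × Fin q) (Fin q × Fin q) ℂ) :
    QuditOp q n :=
  fun x y => if ∀ k, k ≠ a → k ≠ b → x k = y k then V (x a, x b) (y a, y b) else 0

/-- The projector `|0⟩⟨0|` of a single qudit. -/
def ketBraZero (q : ℕ) [NeZero q] : Matrix (Fin q) (Fin q) ℂ :=
  Matrix.single 0 0 1

/-- The initial state `|0…0⟩⟨0…0|` of `n` qudits. -/
def initialState (q n : ℕ) [NeZero q] : QuditOp q n :=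
  Matrix.single (fun _ => 0) (fun _ => 0) 1

/-- The single-qudit channel `ρ ↦ ∑ₖ Eₖ ρ Eₖ†` applied to qudit `a`. -/
def siteChannel {κ : Type*} [Fintype κ] {q n : ℕ} (E : κ → Matrix (Fin q) (Fin q) ℂ)
    (a : Fin n) (ρ : QuditOp q n) : QuditOp q n :=
  ∑ k, onSite a (E k) * ρ * (onSite a (E k))ᴴ

/-! ### Circuits and the rewinding protocol -/

/-- A two-qudit gate placed on the qudits `fst`, `snd` of an `n`-qudit register. -/
structure Gate (q n : ℕ) where
  fst : Fin n
  snd : Fin n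
  unitary : TwoQuditUnitary q

/-- The inverse gate, on the same two qudits. -/
def Gate.inv {q n : ℕ} (g : Gate q n) : Gate q n := ⟨g.fst, g.snd, g.unitary⁻¹⟩

/-- The noise acting on qudit `a` after a gate, where `C` is the list of gates that are still to
come and `i` is the qudit that is read out at the end. The channel is applied, except when `a = i`
and qudit `i` is not touched any more: there the noise would act on `i` immediately before its
read-out, and the output of the last gate on `i` is read out instead. -/
def noiseAfter {κ : Type*} [Fintype κ] {q n : ℕ} (E : κ → Matrix (Fin q) (Fin q) ℂ)
    (i : Fin n) (C : List (Gate q n)) (a : Fin n) (ρ : QuditOp q n) : QuditOp q n :=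
  if a = i ∧ ∀ h ∈ C, h.fst ≠ i ∧ h.snd ≠ i then ρ else siteChannel E a ρ

/-- Run a list of gates (first gate first) on the state `ρ`; every gate is followed by the product
channel `Φ ⊗ Φ`, with Kraus operators `E` for `Φ`, on the two qudits it acts on. -/
def noisyRun {κ : Type*} [Fintype κ] {q n : ℕ} (E : κ → Matrix (Fin q) (Fin q) ℂ)
    (i : Fin n) : List (Gate q n) → QuditOp q n → QuditOp q n
  | [], ρ => ρ
  | g :: C, ρ =>
      noisyRun E i C
        (noiseAfter E i C g.snd
          (noiseAfter E i C g.fst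
            (onPair g.fst g.snd g.unitary.1 * ρ * (onPair g.fst g.snd g.unitary.1)ᴴ)))

/-- The gate number `j` of the convolutional circuit: it acts on the neighbours `j`, `j + 1`. -/
def convGate {q n : ℕ} (U : Fin (n - 1) → TwoQuditUnitary q) (j : Fin (n - 1)) : Gate q n :=
  ⟨⟨j.1, by omega⟩, ⟨j.1 + 1, by omega⟩, U j⟩

/-- The convolutional circuit `U_{[n-1,n]} ⋯ U_{[2,3]} U_{[1,2]}`, as a list, first gate first. -/
def convCircuit {q n : ℕ} (U : Fin (n - 1) → TwoQuditUnitary q) : List (Gate q n) :=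
  (List.finRange (n - 1)).map (convGate U)

/-- The rewinding circuit. The idle qudits are all but the last one; the gates of the convolutional
circuit that act on idle qudits only are inverted, in the reverse order. -/
def rewindCircuit {q n : ℕ} (U : Fin (n - 1) → TwoQuditUnitary q) : List (Gate q n) :=
  (((convCircuit U).filter fun g => g.fst.1 + 1 < n ∧ g.snd.1 + 1 < n).reverse).map Gate.inv

/-- The fidelity `Tr[(|0⟩⟨0|ᵢ ⊗ I) ρ]` of resetting qudit `i` by the noisy convolutional circuit
followed by its noisy rewinding circuit, for given gates `U`. -/
def resetFidelity {κ : Type*} [Fintype κ] {q : ℕ} [NeZero q] (E : κ → Matrix (Fin q) (Fin q) ℂ)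
    (n : ℕ) (i : Fin n) (U : Fin (n - 1) → TwoQuditUnitary q) : ℝ :=
  (Matrix.trace (onSite i (ketBraZero q) *
    noisyRun E i (convCircuit U ++ rewindCircuit U) (initialState q n))).re

/-- The law of `n - 1` independent Haar-random two-qudit gates. -/
def haarGates (q n : ℕ) : Measure (Fin (n - 1) → TwoQuditUnitary q) :=
  Measure.pi fun _ => haarUnitary q

/-- The fidelity of qudit `i`, averaged over independent Haar-random gates. -/
def averagedFidelity {κ : Type*} [Fintype κ] {q : ℕ} [NeZero q]
    (E : κ → Matrix (Fin q) (Fin q) ℂ) (n : ℕ) (i : Fin n) : ℝ :=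
  ∫ U, resetFidelity E n i U ∂(haarGates q n)

/-! ### The parameters of the noise -/

/-- `∑ₖ |Tr Eₖ|² / q²`. -/
def krausAlpha {κ : Type*} [Fintype κ] {q : ℕ} (E : κ → Matrix (Fin q) (Fin q) ℂ) : ℝ :=
  (∑ k, ‖(E k).trace‖ ^ 2) / (q : ℝ) ^ 2

/-- `∑ₖₗ |Tr (Eₖ Eₗ)|² / q²`. -/
def krausBeta {κ : Type*} [Fintype κ] {q : ℕ} (E : κ → Matrix (Fin q) (Fin q) ℂ) : ℝ :=
  (∑ k, ∑ l, ‖(E k * E l).trace‖ ^ 2) / (q : ℝ) ^ 2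

/-- The projector `|φ⟩⟨φ|` onto the maximally entangled state `φ = q^{-1/2} ∑ₖ |k⟩|k⟩`. -/
def maxEntangled (q : ℕ) : Matrix (Fin q × Fin q) (Fin q × Fin q) ℂ :=
  fun x y => if x.1 = x.2 ∧ y.1 = y.2 then (q : ℂ)⁻¹ else 0

/-- The entanglement fidelity `⟨φ| (id ⊗ Φ)(|φ⟩⟨φ|) |φ⟩` of the channel `Φ = ∑ₖ Eₖ · Eₖ†`. -/
def entanglementFidelity {κ : Type*} [Fintype κ] {q : ℕ}
    (E : κ → Matrix (Fin q) (Fin q) ℂ) : ℝ :=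
  (Matrix.trace (maxEntangled q *
    ∑ k, ((1 : Matrix (Fin q) (Fin q) ℂ) ⊗ₖ E k) * maxEntangled q *
      ((1 : Matrix (Fin q) (Fin q) ℂ) ⊗ₖ E k)ᴴ)).re

end

/-! ### Second moments of the Haar measure -/

/-! The circuit is nested: on at least three qudits it is $U_1$, then the whole protocol on all
qudits but the first, then $U_1^\dagger$ (`protocol_cons`). In the Heisenberg picture the final
$U_1^\dagger$ turns an observable $W$ on the first two qudits into $U_1WU_1^\dagger$, while the
initial $U_1$ turns the input $Z$ into $U_1ZU_1^\dagger$. Every quantity to be averaged over $U_1$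
is therefore a bilinear form $h(U_1ZU_1^\dagger,U_1WU_1^\dagger)$, and the second moment of the Haar
measure (`integral_haarUnitary_bilinear`) expresses its mean through $h(1,1)$ and
$\sum_{ij}h(E_{ij},E_{ji})$ alone.

These two numbers factor over the two qudits. Between $U_1$ and $U_1^\dagger$ the first qudit meets
$\Phi$ once, which contributes $\alpha q^2$, the trace of $\Phi$ as a linear map. The second qudit
meets $\Phi$ and then the inner protocol. By induction (`integral_siteForm`), the averaged inner
protocol, seen on its first qudit, is $\Phi$ after a mixture of the identity, with weight $w$, and
complete depolarisation, with weight $1-w$. The identity part thus contributes $w\beta q^2$, where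
$\beta q^2$ is the trace of $\Phi^2$, and the depolarising part $1-w$. The result is a mixture of
the same kind, with $w_{m+1}=\big(\alpha q^2(1+w_m(\beta q^2-1))-1\big)/(q^4-1)$ and $w_0=0$
(`identityWeight`, `integral_pairForm`). This affine recursion has slope $\lambda$ and fixed point
$(\alpha q^2-1)/D$.

A read-out omits the last noise, and its fidelity is $w+(1-w)/q$. Qudits 1 and 2 both have
$U_1^\dagger$ as last gate (when $n\ge3$), so both have weight $w_{n-2}$. For qudit $i>2$ the gate
$U_1^\dagger$ is invisible, and averaging over $U_1$ only replaces the input of the second qudit by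
a maximally mixed one; peeling off such gates reduces to the second qudit of a shorter register,
with weight $w_{n-i}$ (`integral_readout_of_pos`). The bounds $0\le\alpha,\beta\le1$ give
$|\lambda|<1$, and the rest is algebra. -/

theorem exists_perm_of_ne {ι : Type*} [DecidableEq ι] {i j i' j' : ι} (h : i ≠ j) (h' : i' ≠ j') :
    ∃ σ : Equiv.Perm ι, σ i = i' ∧ σ j = j' := by
  refine ⟨Equiv.swap i i' |>.trans (Equiv.swap (Equiv.swap i i' j) j'), ?_, ?_⟩
  · have h1 : Equiv.swap i i' j ≠ i' := by
      intro hc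
      exact h ((Equiv.swap i i').injective (hc.trans (Equiv.swap_apply_left i i').symm)).symm
    simp [Equiv.swap_apply_of_ne_of_ne h1.symm h']
  · simp

/-! ### Tensors invariant under the unitary group: only two pairings of the indices survive. -/

section Commutant

variable {ι : Type*} [Fintype ι] [DecidableEq ι]

/-- Invariance of a tensor with two upper and two lower indices under the action
of the unitary group. -/
def UnitaryInvariant (t : ι → ι → ι → ι → ℂ) : Prop :=
  ∀ V ∈ Matrix.unitaryGroup ι ℂ, ∀ i k j l, t i k j l =
    ∑ i', V i i' * ∑ k', star (V k k') * ∑ j', V j j' * ∑ l', star (V l l') * t i' k' j' l'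

theorem UnitaryInvariant.phase {t : ι → ι → ι → ι → ℂ} (ht : UnitaryInvariant t)
    (a i k j l : ι) :
    t i k j l = (if i = a then Complex.I else 1) * star (if k = a then Complex.I else 1) *
      (if j = a then Complex.I else 1) * star (if l = a then Complex.I else 1) * t i k j l := by
  have hV : Matrix.diagonal (fun x => if x = a then Complex.I else 1) ∈
      Matrix.unitaryGroup ι ℂ := by
    rw [Matrix.mem_unitaryGroup_iff, Matrix.star_eq_conjTranspose, Matrix.diagonal_conjTranspose,
      Matrix.diagonal_mul_diagonal, ← Matrix.diagonal_one]
    congr 1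
    funext x
    by_cases hx : x = a <;> simp [hx]
  have h := ht _ hV i k j l
  simp only [Matrix.diagonal_apply, ite_mul, apply_ite star, star_zero, zero_mul,
    Finset.sum_ite_eq, Finset.mem_univ, if_true] at h
  conv_lhs => rw [h]
  simp only [apply_ite star]
  split_ifs <;> ring

/-- A diagonal unitary with a single entry $\mathrm i$ multiplies the component by a phase, which
differs from 1 for a suitable position of that entry. The value $\mathrm i$ is needed rather than
$-1$: for $i=j$ and $k=l\ne i$ the entry occurs squared. -/
theorem UnitaryInvariant.eq_zero {t : ι → ι → ι → ι → ℂ} (ht : UnitaryInvariant t)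
    {i k j l : ι} (h1 : ¬(i = k ∧ j = l)) (h2 : ¬(i = l ∧ j = k)) : t i k j l = 0 := by
  have aux : ∀ {c z : ℂ}, z = c * z → c ≠ 1 → z = 0 := by
    intro c z h hc
    have : (1 - c) * z = 0 := by linear_combination h
    exact (mul_eq_zero.mp this).resolve_left (sub_ne_zero.mpr hc.symm)
  have hI : Complex.I ≠ 1 := fun h => by simpa using congrArg Complex.re h
  have hI' : -Complex.I ≠ 1 := fun h => by simpa using congrArg Complex.re h
  have hn : (-1 : ℂ) ≠ 1 := by norm_num
  by_cases hik : k = i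
  · subst hik
    have hjl : l ≠ j := fun h => h1 ⟨rfl, h.symm⟩
    refine aux (ht.phase j k k j l) ?_
    by_cases hkj : k = j <;> simp [hkj, hjl, hI]
  · by_cases hil : l = i
    · subst hil
      have hjk : k ≠ j := fun h => h2 ⟨rfl, h.symm⟩
      refine aux (ht.phase j l k j l) ?_
      by_cases hkj : l = j <;> simp [hkj, hjk, hI]
    · refine aux (ht.phase i i k j l) ?_
      by_cases hij : j = i <;> simp [hij, hik, hil, hI, hn]

theorem UnitaryInvariant.perm {t : ι → ι → ι → ι → ℂ} (ht : UnitaryInvariant t)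
    (σ : Equiv.Perm ι) (i k j l : ι) : t i k j l = t (σ i) (σ k) (σ j) (σ l) := by
  have hV : Matrix.of (fun x y => if σ x = y then (1 : ℂ) else 0) ∈
      Matrix.unitaryGroup ι ℂ := by
    rw [Matrix.mem_unitaryGroup_iff]
    ext x y
    simp [Matrix.mul_apply, Matrix.star_apply, apply_ite, Matrix.one_apply, eq_comm]
  have h := ht _ hV i k j l
  simpa only [Matrix.of_apply, ite_mul, apply_ite star, star_zero, star_one, one_mul, zero_mul,
    Finset.sum_ite_eq, Finset.mem_univ, if_true] using h

/-- Phases and permutations leave $t_{aaaa}$, $t_{aabb}$ and $t_{abba}$ unrelated. One unitary that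
mixes $a$ and $b$ supplies the missing relation. -/
theorem UnitaryInvariant.reflection {t : ι → ι → ι → ι → ℂ} (ht : UnitaryInvariant t)
    {a b : ι} (hab : a ≠ b) : t a a a a = t a a b b + t a b b a := by
  -- A rational unit vector: row $a$ of the reflection $1-2vv^{T}$ is then $(c,s)=(7/25,24/25)$.
  set v : ι → ℂ := fun y => if y = a then 3 / 5 else if y = b then -4 / 5 else 0 with hv
  have hsum : ∀ F : ι → ℂ, ∑ y, v y * F y = 3 / 5 * F a - 4 / 5 * F b := by
    intro F
    have : ∀ y, v y * F y = (if y = a then 3 / 5 * F a else 0) -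
        (if y = b then 4 / 5 * F b else 0) := by
      intro y
      by_cases hya : y = a
      · subst hya; simp [hv, hab]
      · by_cases hyb : y = b
        · subst hyb; simp [hv, hya, neg_div]
        · simp [hv, hya, hyb]
    simp [this, Finset.sum_sub_distrib]
  have hvs : star v = v := by
    funext y
    simp only [hv, Pi.star_apply]
    split_ifs <;> simp
  have hvv : v ⬝ᵥ v = 1 := by
    rw [dotProduct, hsum]
    simp [hv, hab.symm]
    norm_num
  have hV : (1 - (2 : ℂ) • Matrix.vecMulVec v v) ∈ Matrix.unitaryGroup ι ℂ := by
    rw [Matrix.mem_unitaryGroup_iff, Matrix.star_eq_conjTranspose]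
    have h1 : (1 - (2 : ℂ) • Matrix.vecMulVec v v)ᴴ = 1 - (2 : ℂ) • Matrix.vecMulVec v v := by
      rw [Matrix.conjTranspose_sub, Matrix.conjTranspose_smul, Matrix.conjTranspose_vecMulVec, hvs]
      simp
    have h2 : Matrix.vecMulVec v v * Matrix.vecMulVec v v = Matrix.vecMulVec v v := by
      rw [Matrix.vecMulVec_mul_vecMulVec, hvv, one_smul]
    rw [h1, sub_mul, mul_sub, mul_sub, smul_mul_smul_comm, h2]
    simp only [mul_one, one_mul]
    module
  have hrow : ∀ F : ι → ℂ, ∑ y, (1 - (2 : ℂ) • Matrix.vecMulVec v v) a y * F y =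
      7 / 25 * F a + 24 / 25 * F b := by
    intro F
    have : ∀ y, (1 - (2 : ℂ) • Matrix.vecMulVec v v) a y * F y =
        (if a = y then F y else 0) - 6 / 5 * (v y * F y) := by
      intro y
      have : v a = 3 / 5 := by simp [hv]
      simp only [Matrix.sub_apply, Matrix.one_apply, Matrix.smul_apply, Matrix.vecMulVec_apply,
        smul_eq_mul, this]
      split_ifs <;> ring
    simp only [this, Finset.sum_sub_distrib, ← Finset.mul_sum, hsum]
    simp
    ring
  have hrow' : ∀ F : ι → ℂ, ∑ y, star ((1 - (2 : ℂ) • Matrix.vecMulVec v v) a y) * F y =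
      7 / 25 * F a + 24 / 25 * F b := by
    intro F
    rw [← hrow]
    refine Finset.sum_congr rfl fun y _ => ?_
    congr 1
    have : star (v y) = v y := congrFun hvs y
    have h' : star (v a) = v a := congrFun hvs a
    simp only [Matrix.sub_apply, Matrix.one_apply, Matrix.smul_apply, Matrix.vecMulVec_apply,
      smul_eq_mul, star_sub, star_mul', this, h']
    split_ifs <;> simp
  have h := ht _ hV a a a a
  simp only [hrow, hrow'] at h
  obtain ⟨σ, hσa, hσb⟩ := exists_perm_of_ne hab hab.symm
  have e1 := ht.perm σ a a a a
  have e2 := ht.perm σ a a b b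
  have e3 := ht.perm σ a b b a
  rw [hσa] at e1
  rw [hσa, hσb] at e2 e3
  have z : ∀ {i k j l : ι}, ¬(i = k ∧ j = l) → ¬(i = l ∧ j = k) → t i k j l = 0 :=
    fun h1 h2 => ht.eq_zero h1 h2
  rw [z (i := a) (k := a) (j := a) (l := b) (by simp [hab]) (by simp [hab]),
    z (i := a) (k := a) (j := b) (l := a) (by simp [hab.symm]) (by simp [hab.symm]),
    z (i := a) (k := b) (j := a) (l := a) (by simp [hab]) (by simp [hab]),
    z (i := b) (k := a) (j := a) (l := a) (by simp [hab.symm]) (by simp [hab.symm]),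
    z (i := a) (k := b) (j := a) (l := b) (by simp [hab]) (by simp [hab]),
    z (i := b) (k := a) (j := b) (l := a) (by simp [hab.symm]) (by simp [hab.symm]),
    z (i := a) (k := b) (j := b) (l := b) (by simp [hab]) (by simp [hab]),
    z (i := b) (k := a) (j := b) (l := b) (by simp [hab.symm]) (by simp [hab.symm]),
    z (i := b) (k := b) (j := a) (l := b) (by simp [hab]) (by simp [hab]),
    z (i := b) (k := b) (j := b) (l := a) (by simp [hab.symm]) (by simp [hab.symm]),
    ← e1, ← e2, ← e3] at h
  -- What remains is $t_{aaaa}=(c^4+s^4)t_{aaaa}+2c^2s^2(t_{aabb}+t_{abba})$, and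
  -- $1-c^4-s^4=2c^2s^2=56448/390625$.
  linear_combination (390625 / 56448 : ℂ) * h

theorem UnitaryInvariant.exists_coeff [Nontrivial ι] {t : ι → ι → ι → ι → ℂ}
    (ht : UnitaryInvariant t) : ∃ B C : ℂ, ∀ i k j l, t i k j l =
      B * ((if i = k then 1 else 0) * (if j = l then 1 else 0)) +
      C * ((if i = l then 1 else 0) * (if j = k then 1 else 0)) := by
  obtain ⟨a, b, hab⟩ := exists_pair_ne ι
  refine ⟨t a a b b, t a b b a, fun i k j l => ?_⟩
  by_cases hij : i = j
  · subst hij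
    by_cases hk : i = k ∧ i = l
    · obtain ⟨rfl, rfl⟩ := hk
      have h := ht.perm (Equiv.swap i a) i i i i
      rw [Equiv.swap_apply_left, ht.reflection hab] at h
      simpa using h
    · rw [ht.eq_zero hk (fun h => hk h.symm)]
      by_cases h1 : i = k
      · have : i ≠ l := fun h => hk ⟨h1, h⟩
        simp [this]
      · simp [h1]
  · obtain ⟨σ, hi, hj⟩ := exists_perm_of_ne hij hab
    by_cases h1 : i = k ∧ j = l
    · obtain ⟨rfl, rfl⟩ := h1
      have h := ht.perm σ i i j j
      rw [hi, hj] at h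
      simpa [hij] using h
    · by_cases h2 : i = l ∧ j = k
      · obtain ⟨rfl, rfl⟩ := h2
        have h := ht.perm σ i j j i
        rw [hi, hj] at h
        simpa [hij] using h
      · rw [ht.eq_zero h1 h2]
        have h1' : ((if i = k then 1 else 0) * (if j = l then 1 else 0) : ℂ) = 0 := by
          by_cases h : i = k
          · have : j ≠ l := fun h' => h1 ⟨h, h'⟩
            simp [this]
          · simp [h]
        have h2' : ((if i = l then 1 else 0) * (if j = k then 1 else 0) : ℂ) = 0 := by
          by_cases h : i = l
          · have : j ≠ k := fun h' => h2 ⟨h, h'⟩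
            simp [this]
          · simp [h]
        rw [h1', h2']; simp

end Commutant

/-! ### First and second moments of Haar-random conjugations. -/

section Haar

variable {q : ℕ}

instance TwoQuditUnitary.secondCountableTopology (q : ℕ) :
    SecondCountableTopology (TwoQuditUnitary q) :=
  haveI : SecondCountableTopology (Matrix (Fin q × Fin q) (Fin q × Fin q) ℂ) :=
    inferInstanceAs (SecondCountableTopology (Fin q × Fin q → Fin q × Fin q → ℂ))
  TopologicalSpace.Subtype.secondCountableTopology _

instance haarUnitary.isMulLeftInvariant (q : ℕ) : (haarUnitary q).IsMulLeftInvariant :=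
  inferInstanceAs (Measure.haarMeasure ⊤).IsMulLeftInvariant

instance haarUnitary.isProbabilityMeasure (q : ℕ) : IsProbabilityMeasure (haarUnitary q) :=
  ⟨by simpa [haarUnitary] using Measure.haarMeasure_self (G := TwoQuditUnitary q) (K₀ := ⊤)⟩

instance haarGates.isProbabilityMeasure (q n : ℕ) : IsProbabilityMeasure (haarGates q n) :=
  inferInstanceAs (IsProbabilityMeasure (Measure.pi fun _ => haarUnitary q))

theorem integrable_of_continuous_compactSpace {X E : Type*} [TopologicalSpace X] [CompactSpace X]
    [MeasurableSpace X] [OpensMeasurableSpace X] [NormedAddCommGroup E] {μ : Measure X}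
    [IsFiniteMeasure μ] {f : X → E} (hf : Continuous f) : Integrable f μ :=
  hf.integrable_of_hasCompactSupport (HasCompactSupport.of_compactSpace f)

/-- The conjugate `U X U†`. -/
def unitaryConj (U : TwoQuditUnitary q) (X : Matrix (Fin q × Fin q) (Fin q × Fin q) ℂ) :
    Matrix (Fin q × Fin q) (Fin q × Fin q) ℂ :=
  U.1 * X * U.1ᴴ

theorem continuous_unitaryConj_apply (X : Matrix (Fin q × Fin q) (Fin q × Fin q) ℂ)
    (i j : Fin q × Fin q) : Continuous fun U : TwoQuditUnitary q => unitaryConj U X i j := by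
  have h : Continuous fun U : TwoQuditUnitary q => unitaryConj U X :=
    (continuous_subtype_val.matrix_mul continuous_const).matrix_mul
      continuous_subtype_val.matrix_conjTranspose
  exact h.matrix_elem i j

theorem unitaryConj_mul_apply (V U : TwoQuditUnitary q)
    (X : Matrix (Fin q × Fin q) (Fin q × Fin q) ℂ) (i k : Fin q × Fin q) :
    unitaryConj (V * U) X i k =
      ∑ i', V.1 i i' * ∑ k', star (V.1 k k') * unitaryConj U X i' k' := by
  have : unitaryConj (V * U) X = V.1 * (unitaryConj U X * V.1ᴴ) := by
    simp only [unitaryConj, Submonoid.coe_mul, Matrix.conjTranspose_mul, Matrix.mul_assoc]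
  rw [this, Matrix.mul_apply]
  refine Finset.sum_congr rfl fun i' _ => ?_
  rw [Matrix.mul_apply]
  simp only [Matrix.conjTranspose_apply, mul_comm]

theorem trace_unitaryConj (U : TwoQuditUnitary q)
    (X : Matrix (Fin q × Fin q) (Fin q × Fin q) ℂ) : (unitaryConj U X).trace = X.trace := by
  have hU : U.1ᴴ * U.1 = 1 := Matrix.mem_unitaryGroup_iff'.mp U.2
  rw [unitaryConj, Matrix.trace_mul_comm, ← Matrix.mul_assoc, hU, Matrix.one_mul]

theorem unitaryConj_mul_unitaryConj (U : TwoQuditUnitary q)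
    (X Y : Matrix (Fin q × Fin q) (Fin q × Fin q) ℂ) :
    unitaryConj U X * unitaryConj U Y = unitaryConj U (X * Y) := by
  have hU : U.1ᴴ * U.1 = 1 := Matrix.mem_unitaryGroup_iff'.mp U.2
  calc U.1 * X * U.1ᴴ * (U.1 * Y * U.1ᴴ) = U.1 * X * (U.1ᴴ * U.1) * Y * U.1ᴴ := by
        simp only [Matrix.mul_assoc]
    _ = unitaryConj U (X * Y) := by rw [hU]; simp only [unitaryConj, Matrix.mul_one, Matrix.mul_assoc]

theorem integrable_unitaryConj_mul (X Y : Matrix (Fin q × Fin q) (Fin q × Fin q) ℂ)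
    (i k j l : Fin q × Fin q) :
    Integrable (fun U => unitaryConj U X i k * unitaryConj U Y j l) (haarUnitary q) :=
  integrable_of_continuous_compactSpace
    ((continuous_unitaryConj_apply X i k).mul (continuous_unitaryConj_apply Y j l))

theorem unitaryInvariant_integral (X Y : Matrix (Fin q × Fin q) (Fin q × Fin q) ℂ) :
    UnitaryInvariant fun i k j l =>
      ∫ U, unitaryConj U X i k * unitaryConj U Y j l ∂(haarUnitary q) := by
  intro V hV i k j l
  have hi := integrable_unitaryConj_mul X Y
  simp only [← integral_const_mul]
  have h1 : ∀ i' k' j', ∑ l', ∫ U, star (V l l') * (unitaryConj U X i' k' * unitaryConj U Y j' l')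
      ∂(haarUnitary q) = ∫ U, ∑ l', star (V l l') *
        (unitaryConj U X i' k' * unitaryConj U Y j' l') ∂(haarUnitary q) := fun i' k' j' =>
    (integral_finsetSum _ fun l' _ => (hi i' k' j' l').const_mul _).symm
  have i1 : ∀ i' k' j', Integrable (fun U => ∑ l', star (V l l') *
        (unitaryConj U X i' k' * unitaryConj U Y j' l')) (haarUnitary q) := fun i' k' j' =>
    integrable_finsetSum _ fun l' _ => (hi i' k' j' l').const_mul _
  simp only [h1, ← integral_const_mul]
  have h2 : ∀ i' k', ∑ j', ∫ U, V j j' * ∑ l', star (V l l') *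
        (unitaryConj U X i' k' * unitaryConj U Y j' l')
      ∂(haarUnitary q) = ∫ U, ∑ j', V j j' * ∑ l', star (V l l') *
        (unitaryConj U X i' k' * unitaryConj U Y j' l') ∂(haarUnitary q) := fun i' k' =>
    (integral_finsetSum _ fun j' _ => (i1 i' k' j').const_mul _).symm
  have i2 : ∀ i' k', Integrable (fun U => ∑ j', V j j' * ∑ l', star (V l l') *
        (unitaryConj U X i' k' * unitaryConj U Y j' l')) (haarUnitary q) := fun i' k' =>
    integrable_finsetSum _ fun j' _ => (i1 i' k' j').const_mul _
  simp only [h2, ← integral_const_mul]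
  have h3 : ∀ i', ∑ k', ∫ U, star (V k k') * ∑ j', V j j' * ∑ l', star (V l l') *
        (unitaryConj U X i' k' * unitaryConj U Y j' l')
      ∂(haarUnitary q) = ∫ U, ∑ k', star (V k k') * ∑ j', V j j' * ∑ l', star (V l l') *
        (unitaryConj U X i' k' * unitaryConj U Y j' l') ∂(haarUnitary q) := fun i' =>
    (integral_finsetSum _ fun k' _ => (i2 i' k').const_mul _).symm
  have i3 : ∀ i', Integrable (fun U => ∑ k', star (V k k') * ∑ j', V j j' * ∑ l', star (V l l') *
        (unitaryConj U X i' k' * unitaryConj U Y j' l')) (haarUnitary q) := fun i' =>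
    integrable_finsetSum _ fun k' _ => (i2 i' k').const_mul _
  simp only [h3, ← integral_const_mul]
  rw [← integral_finsetSum _ fun i' _ => (i3 i').const_mul _]
  -- The sums over $V$ have been moved inside a single integral; left invariance, in the form
  -- $U\mapsto VU$, now matches the integrands pointwise.
  rw [← integral_mul_left_eq_self _ (⟨V, hV⟩ : TwoQuditUnitary q)]
  refine integral_congr_ae (ae_of_all _ fun U => ?_)
  simp only [unitaryConj_mul_apply]
  rw [Finset.sum_mul]
  refine Finset.sum_congr rfl fun i' _ => ?_
  rw [mul_assoc, Finset.sum_mul]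
  congr 1
  refine Finset.sum_congr rfl fun k' _ => ?_
  rw [mul_assoc, Finset.mul_sum]
  congr 1
  refine Finset.sum_congr rfl fun j' _ => ?_
  rw [mul_left_comm, Finset.mul_sum]
  congr 1
  refine Finset.sum_congr rfl fun l' _ => ?_
  ring

/-- This reduces the mean of an arbitrary bilinear form to the entrywise moments classified by
`UnitaryInvariant.exists_coeff`. -/
theorem bilinear_eq_sum {ι : Type*} [Fintype ι] [DecidableEq ι]
    (h : Matrix ι ι ℂ →ₗ[ℂ] Matrix ι ι ℂ →ₗ[ℂ] ℂ) (Z W : Matrix ι ι ℂ) :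
    h Z W = ∑ i, ∑ k, ∑ j, ∑ l, Z i k * W j l *
      h (Matrix.single i k 1) (Matrix.single j l 1) := by
  have e : ∀ (a b : ι) (c : ℂ), Matrix.single a b c = c • Matrix.single a b (1 : ℂ) := by
    intro a b c; simp
  conv_lhs => rw [Matrix.matrix_eq_sum_single Z]
  simp only [map_sum, LinearMap.sum_apply]
  refine Finset.sum_congr rfl fun i _ => Finset.sum_congr rfl fun k _ => ?_
  conv_lhs => rw [Matrix.matrix_eq_sum_single W]
  simp only [map_sum]
  refine Finset.sum_congr rfl fun j _ => Finset.sum_congr rfl fun l _ => ?_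
  rw [e i k, e j l]
  simp only [map_smul, LinearMap.smul_apply, smul_eq_mul]
  ring

theorem sum_mul_kronecker_deltas {ι : Type*} [Fintype ι] [DecidableEq ι] (B C : ℂ)
    (F : ι → ι → ι → ι → ℂ) :
    ∑ i, ∑ k, ∑ j, ∑ l, (B * ((if i = k then 1 else 0) * (if j = l then 1 else 0)) +
      C * ((if i = l then 1 else 0) * (if j = k then 1 else 0))) * F i k j l =
    B * ∑ i, ∑ j, F i i j j + C * ∑ i, ∑ j, F i j j i := by
  simp only [add_mul, Finset.sum_add_distrib, Finset.mul_sum, mul_ite, ite_mul, mul_one, mul_zero,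
    zero_mul, Finset.sum_ite_eq, Finset.mem_univ, if_true, Finset.sum_ite_irrel,
    Finset.sum_const_zero, Finset.sum_ite_eq']

theorem bilinear_one_one {ι : Type*} [Fintype ι] [DecidableEq ι]
    (h : Matrix ι ι ℂ →ₗ[ℂ] Matrix ι ι ℂ →ₗ[ℂ] ℂ) :
    h 1 1 = ∑ i, ∑ j, h (Matrix.single i i 1) (Matrix.single j j 1) := by
  rw [bilinear_eq_sum]
  simp [Matrix.one_apply, Finset.sum_ite_irrel]

/-- The second moment of the Haar measure on `U(q²)`. -/
theorem integral_haarUnitary_bilinear (hq : 2 ≤ q)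
    (X Y : Matrix (Fin q × Fin q) (Fin q × Fin q) ℂ)
    (h : Matrix (Fin q × Fin q) (Fin q × Fin q) ℂ →ₗ[ℂ]
      Matrix (Fin q × Fin q) (Fin q × Fin q) ℂ →ₗ[ℂ] ℂ) :
    ∫ U, h (unitaryConj U X) (unitaryConj U Y) ∂(haarUnitary q) =
      ((X.trace * Y.trace - (X * Y).trace / (q : ℂ) ^ 2) * h 1 1 +
        ((X * Y).trace - X.trace * Y.trace / (q : ℂ) ^ 2) *
          ∑ i, ∑ j, h (Matrix.single i j 1) (Matrix.single j i 1)) / ((q : ℂ) ^ 4 - 1) := by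
  have : Nontrivial (Fin q) := Fin.nontrivial_iff_two_le.mpr hq
  have : Nonempty (Fin q) := ⟨⟨0, by omega⟩⟩
  obtain ⟨B, C, ht⟩ := (unitaryInvariant_integral X Y).exists_coeff
  have hi := integrable_unitaryConj_mul X Y
  have key : ∀ h : Matrix (Fin q × Fin q) (Fin q × Fin q) ℂ →ₗ[ℂ]
      Matrix (Fin q × Fin q) (Fin q × Fin q) ℂ →ₗ[ℂ] ℂ,
      ∫ U, h (unitaryConj U X) (unitaryConj U Y) ∂(haarUnitary q) =
        B * h 1 1 + C * ∑ i, ∑ j, h (Matrix.single i j 1) (Matrix.single j i 1) := by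
    intro h
    simp only [bilinear_eq_sum h (unitaryConj _ X)]
    rw [integral_finsetSum _ fun i _ => integrable_finsetSum _ fun k _ =>
      integrable_finsetSum _ fun j _ => integrable_finsetSum _ fun l _ =>
        (hi i k j l).mul_const _]
    have : ∀ i, ∫ U, ∑ k, ∑ j, ∑ l, unitaryConj U X i k * unitaryConj U Y j l *
        h (Matrix.single i k 1) (Matrix.single j l 1) ∂(haarUnitary q) =
        ∑ k, ∑ j, ∑ l, (B * ((if i = k then 1 else 0) * (if j = l then 1 else 0)) +
          C * ((if i = l then 1 else 0) * (if j = k then 1 else 0))) *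
            h (Matrix.single i k 1) (Matrix.single j l 1) := by
      intro i
      rw [integral_finsetSum _ fun k _ => integrable_finsetSum _ fun j _ =>
        integrable_finsetSum _ fun l _ => (hi i k j l).mul_const _]
      refine Finset.sum_congr rfl fun k _ => ?_
      rw [integral_finsetSum _ fun j _ =>
        integrable_finsetSum _ fun l _ => (hi i k j l).mul_const _]
      refine Finset.sum_congr rfl fun j _ => ?_
      rw [integral_finsetSum _ fun l _ => (hi i k j l).mul_const _]
      refine Finset.sum_congr rfl fun l _ => ?_
      rw [integral_mul_const, ← ht i k j l]
    simp only [this]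
    rw [sum_mul_kronecker_deltas, bilinear_one_one]
  have hd : (q : ℂ) ≠ 0 := by
    have : q ≠ 0 := by omega
    exact_mod_cast this
  have hd4 : (q : ℂ) ^ 4 - 1 ≠ 0 := by
    have h1 : 1 < q ^ 4 := Nat.one_lt_pow (by norm_num) (by omega)
    have h2 : (q : ℂ) ^ 4 ≠ 1 := by exact_mod_cast h1.ne'
    exact sub_ne_zero.mpr h2
  -- The forms $\mathrm{Tr}\,Z\,\mathrm{Tr}\,W$ and $\mathrm{Tr}(ZW)$ do not change under
  -- simultaneous conjugation, so their means are known. They give two linear equations that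
  -- determine $B$ and $C$.
  let h1 : Matrix (Fin q × Fin q) (Fin q × Fin q) ℂ →ₗ[ℂ]
      Matrix (Fin q × Fin q) (Fin q × Fin q) ℂ →ₗ[ℂ] ℂ :=
    (LinearMap.mul ℂ ℂ).compl₁₂ (Matrix.traceLinearMap _ ℂ ℂ) (Matrix.traceLinearMap _ ℂ ℂ)
  let h2 : Matrix (Fin q × Fin q) (Fin q × Fin q) ℂ →ₗ[ℂ]
      Matrix (Fin q × Fin q) (Fin q × Fin q) ℂ →ₗ[ℂ] ℂ :=
    (LinearMap.mul ℂ _).compr₂ (Matrix.traceLinearMap _ ℂ ℂ)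
  have e1 := key h1
  have e2 := key h2
  have c1 : X.trace * Y.trace = B * ((q : ℂ) ^ 2 * (q : ℂ) ^ 2) + C * (q : ℂ) ^ 2 := by
    have hs : ∀ i j : Fin q × Fin q, (Matrix.single i j (1 : ℂ)).trace =
        if i = j then 1 else 0 := by
      intro i j
      by_cases hij : i = j
      · subst hij; simp
      · rw [Matrix.trace_single_eq_of_ne _ _ _ hij, if_neg hij]
    simpa [h1, trace_unitaryConj, hs, pow_two] using e1
  have c2 : (X * Y).trace = B * (q : ℂ) ^ 2 + C * ((q : ℂ) ^ 2 * (q : ℂ) ^ 2) := by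
    simpa [h2, unitaryConj_mul_unitaryConj, trace_unitaryConj, pow_two]
      using e2
  rw [key h]
  rw [c1, c2]
  field_simp
  ring

/-- The first moment of the Haar measure on `U(q²)`. -/
theorem integral_haarUnitary_linear (hq : 2 ≤ q)
    (X : Matrix (Fin q × Fin q) (Fin q × Fin q) ℂ)
    (h : Matrix (Fin q × Fin q) (Fin q × Fin q) ℂ →ₗ[ℂ] ℂ) :
    ∫ U, h (unitaryConj U X) ∂(haarUnitary q) = X.trace * h 1 / (q : ℂ) ^ 2 := by
  have hd : (q : ℂ) ≠ 0 := by
    have : q ≠ 0 := by omega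
    exact_mod_cast this
  have hd4 : (q : ℂ) ^ 4 - 1 ≠ 0 := by
    have h1 : 1 < q ^ 4 := Nat.one_lt_pow (by norm_num) (by omega)
    have h2 : (q : ℂ) ^ 4 ≠ 1 := by exact_mod_cast h1.ne'
    exact sub_ne_zero.mpr h2
  -- Multiplying `h` by the trace in a second slot filled with the identity makes the first moment a
  -- case of the second.
  have e := integral_haarUnitary_bilinear hq X 1
    ((LinearMap.mul ℂ ℂ).compl₁₂ h (Matrix.traceLinearMap _ ℂ ℂ))
  have ht : (1 : Matrix (Fin q × Fin q) (Fin q × Fin q) ℂ).trace = (q : ℂ) ^ 2 := by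
    simp [pow_two]
  simp only [LinearMap.compl₁₂_apply, LinearMap.mul_apply', Matrix.traceLinearMap_apply,
    trace_unitaryConj, ht, Matrix.mul_one] at e
  rw [integral_mul_const] at e
  have : (∫ U, h (unitaryConj U X) ∂(haarUnitary q)) * (q : ℂ) ^ 2 = X.trace * h 1 := by
    rw [e, mul_div_cancel_right₀ _ (pow_ne_zero 2 hd), sub_self, zero_mul, add_zero]
    field_simp
  rw [← this]
  field_simp

end Haar

/-! ### Splitting off the first qudits -/

section Tensor

variable {q m : ℕ}

/-- The operator `A ⊗ B`, with `A` on the first qudit and `B` on the other ones. -/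
def tens (A : Matrix (Fin q) (Fin q) ℂ) (B : QuditOp q m) : QuditOp q (m + 1) :=
  fun u v => A (u 0) (v 0) * B (Fin.tail u) (Fin.tail v)

/-- The operator `Z ⊗ B`, with `Z` on the first two qudits and `B` on the other ones. -/
def tensPair (Z : Matrix (Fin q × Fin q) (Fin q × Fin q) ℂ) (B : QuditOp q m) :
    QuditOp q (m + 2) :=
  fun u v => Z (u 0, u 1) (v 0, v 1) * B (Fin.tail (Fin.tail u)) (Fin.tail (Fin.tail v))

theorem sum_fin_cons {M : Type*} [AddCommMonoid M] (F : (Fin (m + 1) → Fin q) → M) :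
    ∑ u, F u = ∑ x, ∑ u', F (Fin.cons x u') := by
  rw [← Fintype.sum_prod_type' (f := fun x u' => F (Fin.cons x u'))]
  exact (Fintype.sum_equiv (Fin.consEquiv fun _ => Fin q) _ _ fun _ => rfl).symm

theorem tens_mul_tens (A C : Matrix (Fin q) (Fin q) ℂ) (B D : QuditOp q m) :
    tens A B * tens C D = tens (A * C) (B * D) := by
  ext u v
  simp only [tens, Matrix.mul_apply, sum_fin_cons, Fin.cons_zero, Fin.tail_cons,
    Finset.sum_mul_sum]
  refine Finset.sum_congr rfl fun x _ => Finset.sum_congr rfl fun y _ => ?_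
  ring

theorem eq_iff_head_tail {u v : Fin (m + 1) → Fin q} :
    u = v ↔ u 0 = v 0 ∧ Fin.tail u = Fin.tail v := by
  constructor
  · rintro rfl; exact ⟨rfl, rfl⟩
  · rintro ⟨h1, h2⟩
    rw [← Fin.cons_self_tail u, ← Fin.cons_self_tail v, h1, h2]

theorem tens_one_one : tens (1 : Matrix (Fin q) (Fin q) ℂ) (1 : QuditOp q m) = 1 := by
  ext u v
  simp only [tens, Matrix.one_apply, eq_iff_head_tail (u := u)]
  by_cases h1 : u 0 = v 0 <;> by_cases h2 : Fin.tail u = Fin.tail v <;> simp [h1, h2]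

theorem tens_conjTranspose (A : Matrix (Fin q) (Fin q) ℂ) (B : QuditOp q m) :
    (tens A B)ᴴ = tens Aᴴ Bᴴ := by
  ext u v
  simp [tens, Matrix.conjTranspose_apply]

theorem trace_tens (A : Matrix (Fin q) (Fin q) ℂ) (B : QuditOp q m) :
    (tens A B).trace = A.trace * B.trace := by
  simp only [Matrix.trace, Matrix.diag, sum_fin_cons, tens, Fin.cons_zero, Fin.tail_cons,
    Finset.sum_mul_sum]

theorem tens_sum_left {κ : Type*} (s : Finset κ) (A : κ → Matrix (Fin q) (Fin q) ℂ)
    (B : QuditOp q m) : tens (∑ k ∈ s, A k) B = ∑ k ∈ s, tens (A k) B := by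
  ext u v
  simp only [tens, Matrix.sum_apply, Finset.sum_mul]

theorem tens_sum_right {κ : Type*} (s : Finset κ) (A : Matrix (Fin q) (Fin q) ℂ)
    (B : κ → QuditOp q m) : tens A (∑ k ∈ s, B k) = ∑ k ∈ s, tens A (B k) := by
  ext u v
  simp only [tens, Matrix.sum_apply, Finset.mul_sum]

theorem tensPair_add_left (Z Z' : Matrix (Fin q × Fin q) (Fin q × Fin q) ℂ) (B : QuditOp q m) :
    tensPair (Z + Z') B = tensPair Z B + tensPair Z' B := by
  ext u v; simp only [tensPair, Matrix.add_apply, add_mul]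

theorem tensPair_smul_left (c : ℂ) (Z : Matrix (Fin q × Fin q) (Fin q × Fin q) ℂ)
    (B : QuditOp q m) : tensPair (c • Z) B = c • tensPair Z B := by
  ext u v; simp only [tensPair, Matrix.smul_apply, smul_eq_mul, mul_assoc]

theorem tensPair_kronecker (A B : Matrix (Fin q) (Fin q) ℂ) (C : QuditOp q m) :
    tensPair (A ⊗ₖ B) C = tens A (tens B C) := by
  ext u v
  simp only [tensPair, tens, Matrix.kronecker_apply, mul_assoc]
  rfl

theorem tensPair_mul_tensPair (Z W : Matrix (Fin q × Fin q) (Fin q × Fin q) ℂ)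
    (B D : QuditOp q m) : tensPair Z B * tensPair W D = tensPair (Z * W) (B * D) := by
  ext u v
  have h1 : ∀ (x : Fin q) (w : Fin (m + 1) → Fin q),
      (Fin.cons (α := fun _ => Fin q) x w : Fin (m + 2) → Fin q) 1 = w 0 := fun x w => rfl
  simp only [tensPair, Matrix.mul_apply, sum_fin_cons, Fin.cons_zero, Fin.tail_cons,
    Fintype.sum_prod_type, h1]
  rw [Finset.sum_mul]
  refine Finset.sum_congr rfl fun x _ => ?_
  rw [Finset.sum_mul]
  refine Finset.sum_congr rfl fun y _ => ?_
  rw [Finset.mul_sum]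
  refine Finset.sum_congr rfl fun w _ => ?_
  ring

theorem tensPair_conjTranspose (Z : Matrix (Fin q × Fin q) (Fin q × Fin q) ℂ)
    (B : QuditOp q m) : (tensPair Z B)ᴴ = tensPair Zᴴ Bᴴ := by
  ext u v
  simp [tensPair, Matrix.conjTranspose_apply]

theorem trace_tensPair (Z : Matrix (Fin q × Fin q) (Fin q × Fin q) ℂ) (B : QuditOp q m) :
    (tensPair Z B).trace = Z.trace * B.trace := by
  have h1 : ∀ (x : Fin q) (w : Fin (m + 1) → Fin q),
      (Fin.cons (α := fun _ => Fin q) x w : Fin (m + 2) → Fin q) 1 = w 0 := fun x w => rfl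
  simp only [Matrix.trace, Matrix.diag, sum_fin_cons, tensPair, Fin.cons_zero, Fin.tail_cons, h1,
    Fintype.sum_prod_type]
  simp only [Finset.sum_mul, ← Finset.mul_sum]

theorem onSite_zero (A : Matrix (Fin q) (Fin q) ℂ) :
    onSite (0 : Fin (m + 1)) A = tens A 1 := by
  ext u v
  have h : (∀ k : Fin (m + 1), k ≠ 0 → u k = v k) ↔ Fin.tail u = Fin.tail v := by
    simp [Fin.forall_fin_succ, funext_iff, Fin.tail, Fin.succ_ne_zero]
  simp only [onSite, tens, Matrix.one_apply, h]
  split_ifs <;> simp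

theorem onSite_succ (a : Fin m) (A : Matrix (Fin q) (Fin q) ℂ) :
    onSite a.succ A = tens 1 (onSite a A) := by
  ext u v
  have h : (∀ k : Fin (m + 1), k ≠ a.succ → u k = v k) ↔
      u 0 = v 0 ∧ ∀ k, k ≠ a → Fin.tail u k = Fin.tail v k := by
    simp [Fin.forall_fin_succ, Fin.tail, (Fin.succ_ne_zero a).symm]
  simp only [onSite, tens, Matrix.one_apply, h, ite_mul, one_mul, zero_mul, ite_and]
  rfl

theorem onSite_one (A : Matrix (Fin q) (Fin q) ℂ) :
    onSite (1 : Fin (m + 2)) A = tens 1 (tens A 1) := by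
  rw [← onSite_zero]
  exact onSite_succ (m := m + 1) 0 A

theorem onPair_zero_one (V : Matrix (Fin q × Fin q) (Fin q × Fin q) ℂ) :
    onPair (0 : Fin (m + 2)) 1 V = tensPair V 1 := by
  ext u v
  have h : (∀ k : Fin (m + 2), k ≠ 0 → k ≠ 1 → u k = v k) ↔
      Fin.tail (Fin.tail u) = Fin.tail (Fin.tail v) := by
    have h1 : (1 : Fin (m + 2)) = Fin.succ 0 := rfl
    rw [h1]
    simp only [Fin.forall_fin_succ, funext_iff, Fin.tail, Fin.succ_inj, ne_eq,
      Fin.succ_ne_zero, not_true_eq_false, not_false_eq_true, true_implies, false_implies,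
      true_and]
  simp only [onPair, tensPair, Matrix.one_apply, h]
  split_ifs <;> simp

theorem onPair_succ (a b : Fin m) (V : Matrix (Fin q × Fin q) (Fin q × Fin q) ℂ) :
    onPair a.succ b.succ V = tens 1 (onPair a b V) := by
  ext u v
  have h : (∀ k : Fin (m + 1), k ≠ a.succ → k ≠ b.succ → u k = v k) ↔
      u 0 = v 0 ∧ ∀ k, k ≠ a → k ≠ b → Fin.tail u k = Fin.tail v k := by
    simp [Fin.forall_fin_succ, Fin.tail, (Fin.succ_ne_zero a).symm, (Fin.succ_ne_zero b).symm]
  simp only [onPair, tens, Matrix.one_apply, h, ite_mul, one_mul, zero_mul, ite_and]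
  rfl

theorem initialState_succ [NeZero q] :
    initialState q (m + 1) = tens (ketBraZero q) (initialState q m) := by
  ext u v
  have h : ∀ w : Fin (m + 1) → Fin q, (fun _ => 0) = w ↔ 0 = w 0 ∧ (fun _ => 0) = Fin.tail w :=
    fun w => eq_iff_head_tail
  simp only [initialState, ketBraZero, tens, Matrix.single_apply, h, ← ite_and, mul_ite, ite_mul,
    one_mul, zero_mul, mul_zero]
  congr 1
  apply propext
  tauto

end Tensor

/-! ### Runs as linear maps -/

section Runs

variable {κ : Type*} [Fintype κ] {q n m : ℕ}

/-- The linear map `ρ ↦ A ρ A†`. -/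
def conjLin {ι : Type*} [Fintype ι] (A : Matrix ι ι ℂ) : Matrix ι ι ℂ →ₗ[ℂ] Matrix ι ι ℂ where
  toFun ρ := A * ρ * Aᴴ
  map_add' := by intro x y; rw [Matrix.mul_add, Matrix.add_mul]
  map_smul' := by intro c x; simp

/-- The single-qudit channel as a linear map. -/
def channel (E : κ → Matrix (Fin q) (Fin q) ℂ) :
    Matrix (Fin q) (Fin q) ℂ →ₗ[ℂ] Matrix (Fin q) (Fin q) ℂ :=
  ∑ k, conjLin (E k)

theorem channel_apply (E : κ → Matrix (Fin q) (Fin q) ℂ) (X : Matrix (Fin q) (Fin q) ℂ) :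
    channel E X = ∑ k, E k * X * (E k)ᴴ := by
  simp [channel, conjLin, LinearMap.sum_apply]

/-- The single-qudit channel on qudit `a` as a linear map. -/
def siteChannelLin (E : κ → Matrix (Fin q) (Fin q) ℂ) (a : Fin n) :
    QuditOp q n →ₗ[ℂ] QuditOp q n :=
  ∑ k, conjLin (onSite a (E k))

theorem siteChannelLin_apply (E : κ → Matrix (Fin q) (Fin q) ℂ) (a : Fin n) (ρ : QuditOp q n) :
    siteChannelLin E a ρ = siteChannel E a ρ := by
  simp [siteChannelLin, siteChannel, conjLin, LinearMap.sum_apply]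

/-- A gate followed by the noise on both qudits. -/
def gateStep (E : κ → Matrix (Fin q) (Fin q) ℂ) (g : Gate q n) :
    QuditOp q n →ₗ[ℂ] QuditOp q n :=
  siteChannelLin E g.snd ∘ₗ siteChannelLin E g.fst ∘ₗ conjLin (onPair g.fst g.snd g.unitary.1)

/-- A list of gates, each of which is followed by the noise on both qudits. -/
def fullRun (E : κ → Matrix (Fin q) (Fin q) ℂ) :
    List (Gate q n) → QuditOp q n →ₗ[ℂ] QuditOp q n
  | [] => LinearMap.id
  | g :: C => fullRun E C ∘ₗ gateStep E g

/-- `noisyRun` as a linear map. -/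
def noisyRunLin (E : κ → Matrix (Fin q) (Fin q) ℂ) (i : Fin n) :
    List (Gate q n) → QuditOp q n →ₗ[ℂ] QuditOp q n
  | [] => LinearMap.id
  | g :: C => noisyRunLin E i C ∘ₗ
      (if g.snd = i ∧ ∀ h ∈ C, h.fst ≠ i ∧ h.snd ≠ i then LinearMap.id
        else siteChannelLin E g.snd) ∘ₗ
      (if g.fst = i ∧ ∀ h ∈ C, h.fst ≠ i ∧ h.snd ≠ i then LinearMap.id
        else siteChannelLin E g.fst) ∘ₗ conjLin (onPair g.fst g.snd g.unitary.1)

theorem noisyRunLin_apply (E : κ → Matrix (Fin q) (Fin q) ℂ) (i : Fin n) (C : List (Gate q n))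
    (ρ : QuditOp q n) : noisyRunLin E i C ρ = noisyRun E i C ρ := by
  induction C generalizing ρ with
  | nil => rfl
  | cons g C ih =>
    simp only [noisyRunLin, noisyRun, LinearMap.comp_apply, ih, noiseAfter]
    split_ifs <;> simp only [LinearMap.id_apply, siteChannelLin_apply] <;> rfl

theorem fullRun_cons (E : κ → Matrix (Fin q) (Fin q) ℂ) (g : Gate q n) (C : List (Gate q n))
    (ρ : QuditOp q n) : fullRun E (g :: C) ρ = fullRun E C (gateStep E g ρ) := rfl

theorem noisyRunLin_cons_of_pos (E : κ → Matrix (Fin q) (Fin q) ℂ) (i : Fin n) (g : Gate q n)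
    {C : List (Gate q n)} (h : (g.fst ≠ i ∧ g.snd ≠ i) ∨ ∃ g ∈ C, g.fst = i ∨ g.snd = i)
    (ρ : QuditOp q n) : noisyRunLin E i (g :: C) ρ = noisyRunLin E i C (gateStep E g ρ) := by
  have h1 : ¬(g.fst = i ∧ ∀ h ∈ C, h.fst ≠ i ∧ h.snd ≠ i) := by
    rintro ⟨h1, h2⟩
    rcases h with h | ⟨g', hg', h'⟩
    · exact h.1 h1
    · have := h2 g' hg'; tauto
  have h2 : ¬(g.snd = i ∧ ∀ h ∈ C, h.fst ≠ i ∧ h.snd ≠ i) := by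
    rintro ⟨h1, h2⟩
    rcases h with h | ⟨g', hg', h'⟩
    · exact h.2 h1
    · have := h2 g' hg'; tauto
  rw [noisyRunLin, if_neg h1, if_neg h2]
  rfl

/-- As long as a gate on qudit `i` is still to come, no noise is omitted. -/
theorem noisyRunLin_append_of_touched (E : κ → Matrix (Fin q) (Fin q) ℂ) {i : Fin n}
    (C₁ : List (Gate q n)) {C₂ : List (Gate q n)} (h : ∃ g ∈ C₂, g.fst = i ∨ g.snd = i)
    (ρ : QuditOp q n) :
    noisyRunLin E i (C₁ ++ C₂) ρ = noisyRunLin E i C₂ (fullRun E C₁ ρ) := by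
  induction C₁ generalizing ρ with
  | nil => rfl
  | cons g C ih =>
    obtain ⟨g', hg', h'⟩ := h
    rw [List.cons_append, noisyRunLin_cons_of_pos E i g
      (Or.inr ⟨g', List.mem_append_right _ hg', h'⟩), ih, fullRun_cons]

theorem noisyRunLin_of_untouched (E : κ → Matrix (Fin q) (Fin q) ℂ) {i : Fin n}
    {C : List (Gate q n)} (h : ∀ g ∈ C, g.fst ≠ i ∧ g.snd ≠ i) (ρ : QuditOp q n) :
    noisyRunLin E i C ρ = fullRun E C ρ := by
  induction C generalizing ρ with
  | nil => rfl
  | cons g C ih =>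
    rw [noisyRunLin_cons_of_pos E i g (Or.inl (h g List.mem_cons_self)), fullRun_cons,
      ih fun g' hg' => h g' (List.mem_cons_of_mem _ hg')]

/-- Later gates away from `i` do not affect which noise counts as the last one on `i`. -/
theorem noisyRunLin_append_of_untouched (E : κ → Matrix (Fin q) (Fin q) ℂ) {i : Fin n}
    (C₁ : List (Gate q n)) {C₂ : List (Gate q n)} (h : ∀ g ∈ C₂, g.fst ≠ i ∧ g.snd ≠ i)
    (ρ : QuditOp q n) :
    noisyRunLin E i (C₁ ++ C₂) ρ = fullRun E C₂ (noisyRunLin E i C₁ ρ) := by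
  induction C₁ generalizing ρ with
  | nil => exact noisyRunLin_of_untouched E h ρ
  | cons g C ih =>
    have hn : (∀ h ∈ C ++ C₂, h.fst ≠ i ∧ h.snd ≠ i) ↔ ∀ h ∈ C, h.fst ≠ i ∧ h.snd ≠ i := by
      simp only [List.mem_append]
      exact ⟨fun h' g hg => h' g (Or.inl hg), fun h' g hg => hg.elim (h' g) (h g)⟩
    rw [List.cons_append, noisyRunLin, noisyRunLin]
    simp only [hn]
    rw [LinearMap.comp_apply, ih]
    rfl

theorem fullRun_append (E : κ → Matrix (Fin q) (Fin q) ℂ) (C₁ C₂ : List (Gate q n))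
    (ρ : QuditOp q n) : fullRun E (C₁ ++ C₂) ρ = fullRun E C₂ (fullRun E C₁ ρ) := by
  induction C₁ generalizing ρ with
  | nil => rfl
  | cons g C ih => rw [List.cons_append, fullRun_cons, fullRun_cons, ih]

/-- The gate on the next two qudits of a register with one more qudit at its beginning. -/
def Gate.shift (g : Gate q n) : Gate q (n + 1) := ⟨g.fst.succ, g.snd.succ, g.unitary⟩

theorem conjLin_tens (A C : Matrix (Fin q) (Fin q) ℂ) (B D : QuditOp q m) :
    conjLin (tens A B) (tens C D) = tens (conjLin A C) (conjLin B D) := by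
  simp only [conjLin, LinearMap.coe_mk, AddHom.coe_mk, tens_conjTranspose, tens_mul_tens]

theorem conjLin_one {ι : Type*} [Fintype ι] [DecidableEq ι] (A : Matrix ι ι ℂ) :
    conjLin 1 A = A := by
  simp [conjLin]

theorem siteChannelLin_zero_tens (E : κ → Matrix (Fin q) (Fin q) ℂ)
    (A : Matrix (Fin q) (Fin q) ℂ) (B : QuditOp q m) :
    siteChannelLin E 0 (tens A B) = tens (channel E A) B := by
  simp only [siteChannelLin, channel, LinearMap.sum_apply, onSite_zero, conjLin_tens, conjLin_one,
    tens_sum_left]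

theorem siteChannelLin_succ_tens (E : κ → Matrix (Fin q) (Fin q) ℂ) (a : Fin m)
    (A : Matrix (Fin q) (Fin q) ℂ) (B : QuditOp q m) :
    siteChannelLin E a.succ (tens A B) = tens A (siteChannelLin E a B) := by
  simp only [siteChannelLin, LinearMap.sum_apply, onSite_succ, conjLin_tens, conjLin_one,
    tens_sum_right]

theorem siteChannelLin_one_tens (E : κ → Matrix (Fin q) (Fin q) ℂ)
    (A B : Matrix (Fin q) (Fin q) ℂ) (C : QuditOp q m) :
    siteChannelLin E 1 (tens A (tens B C)) = tens A (tens (channel E B) C) := by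
  rw [← siteChannelLin_zero_tens]
  exact siteChannelLin_succ_tens (m := m + 1) E 0 A (tens B C)

theorem conjLin_onPair_shift (g : Gate q n) (A : Matrix (Fin q) (Fin q) ℂ) (B : QuditOp q n) :
    conjLin (onPair g.shift.fst g.shift.snd g.shift.unitary.1) (tens A B) =
      tens A (conjLin (onPair g.fst g.snd g.unitary.1) B) := by
  simp only [Gate.shift, onPair_succ, conjLin_tens, conjLin_one]

theorem fullRun_shift (E : κ → Matrix (Fin q) (Fin q) ℂ) (C : List (Gate q n))
    (A : Matrix (Fin q) (Fin q) ℂ) (B : QuditOp q n) :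
    fullRun E (C.map Gate.shift) (tens A B) = tens A (fullRun E C B) := by
  induction C generalizing B with
  | nil => rfl
  | cons g C ih =>
    simp only [List.map_cons, fullRun, gateStep, LinearMap.comp_apply, conjLin_onPair_shift]
    simp only [Gate.shift, siteChannelLin_succ_tens, ih]

theorem noisyRunLin_shift (E : κ → Matrix (Fin q) (Fin q) ℂ) (i : Fin n) (C : List (Gate q n))
    (A : Matrix (Fin q) (Fin q) ℂ) (B : QuditOp q n) :
    noisyRunLin E i.succ (C.map Gate.shift) (tens A B) = tens A (noisyRunLin E i C B) := by
  induction C generalizing B with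
  | nil => rfl
  | cons g C ih =>
    have hn : (∀ h ∈ C.map Gate.shift, h.fst ≠ i.succ ∧ h.snd ≠ i.succ) ↔
        ∀ h ∈ C, h.fst ≠ i ∧ h.snd ≠ i := by
      simp [Gate.shift]
    have h1 : g.shift.fst = i.succ ↔ g.fst = i := by simp [Gate.shift]
    have h2 : g.shift.snd = i.succ ↔ g.snd = i := by simp [Gate.shift]
    simp only [List.map_cons, noisyRunLin, LinearMap.comp_apply, conjLin_onPair_shift, hn, h1, h2]
    have e : ∀ (P : Prop) [Decidable P] (a : Fin n) (B : QuditOp q n),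
        (if P then LinearMap.id else siteChannelLin E a.succ) (tens A B) =
          tens A ((if P then LinearMap.id else siteChannelLin E a) B) := by
      intro P _ a B
      split_ifs
      · rfl
      · exact siteChannelLin_succ_tens E a A B
    simp only [Gate.shift, e, ih]

end Runs

/-! ### The structure of the protocol -/

section Protocol

variable {κ : Type*} [Fintype κ] {q n m : ℕ}

/-- The convolutional circuit followed by the rewinding circuit. -/
def protocol (U : Fin m → TwoQuditUnitary q) : List (Gate q (m + 1)) :=
  convCircuit (n := m + 1) U ++ rewindCircuit (n := m + 1) U

theorem convCircuit_cons (U : TwoQuditUnitary q) (V : Fin (m + 1) → TwoQuditUnitary q) :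
    convCircuit (n := m + 3) (Fin.cons U V : Fin (m + 2) → TwoQuditUnitary q) =
      ⟨0, 1, U⟩ :: (convCircuit (n := m + 2) V).map Gate.shift := by
  change (List.finRange (m + 2)).map _ = _ :: ((List.finRange (m + 1)).map _).map _
  rw [List.finRange_succ, List.map_cons, List.map_map, List.map_map]
  rfl

theorem rewindCircuit_cons (U : TwoQuditUnitary q) (V : Fin (m + 1) → TwoQuditUnitary q) :
    rewindCircuit (n := m + 3) (Fin.cons U V : Fin (m + 2) → TwoQuditUnitary q) =
      (rewindCircuit (n := m + 2) V).map Gate.shift ++ [⟨0, 1, U⁻¹⟩] := by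
  rw [rewindCircuit, rewindCircuit, convCircuit_cons, List.filter_cons_of_pos (by simp),
    List.reverse_cons, List.map_append, List.filter_map, ← List.map_reverse, List.map_map,
    List.map_map]
  have h : (fun g : Gate q (m + 3) => decide (g.fst.1 + 1 < m + 3 ∧ g.snd.1 + 1 < m + 3)) ∘
      Gate.shift = fun g : Gate q (m + 2) => decide (g.fst.1 + 1 < m + 2 ∧ g.snd.1 + 1 < m + 2) := by
    funext g
    simp [Gate.shift]
  rw [h]
  rfl

/-- The recursive structure behind all inductions. At least three qudits are needed: on two qudits
the only gate touches the last qudit and is not rewound, as in `protocol_two`. -/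
theorem protocol_cons (U : TwoQuditUnitary q) (V : Fin (m + 1) → TwoQuditUnitary q) :
    protocol (Fin.cons U V : Fin (m + 2) → TwoQuditUnitary q) =
      ⟨0, 1, U⟩ :: (protocol V).map Gate.shift ++ [⟨0, 1, U⁻¹⟩] := by
  rw [protocol, convCircuit_cons, rewindCircuit_cons, protocol, List.map_append]
  simp only [List.cons_append, List.append_assoc]

theorem protocol_two (U : TwoQuditUnitary q) (V : Fin 0 → TwoQuditUnitary q) :
    protocol (Fin.cons U V : Fin 1 → TwoQuditUnitary q) = [⟨0, 1, U⟩] := by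
  have h : convCircuit (n := 2) (Fin.cons U V : Fin 1 → TwoQuditUnitary q) = [⟨0, 1, U⟩] := by
    change (List.finRange 1).map _ = _
    rw [List.finRange_succ]
    rfl
  rw [protocol, rewindCircuit, h]
  simp

/-- A list of gates with fixed positions and unitaries that depend on a parameter. -/
def evalGates {T : Type*} (C : List (Fin n × Fin n × (T → TwoQuditUnitary q))) (x : T) :
    List (Gate q n) :=
  C.map fun p => ⟨p.1, p.2.1, p.2.2 x⟩

/-- The positions of the gates, and with them the choice of the omitted noise, do not depend on the
unitaries. Continuity of a run can then be proved by induction on a fixed list, and integrability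
follows by compactness. -/
theorem exists_evalGates_eq_circuit : ∃ C : List (Fin n × Fin n ×
      ((Fin (n - 1) → TwoQuditUnitary q) → TwoQuditUnitary q)),
    (∀ p ∈ C, Continuous p.2.2) ∧ ∀ U, evalGates C U = convCircuit U ++ rewindCircuit U := by
  refine ⟨(List.finRange (n - 1)).map (fun j => (⟨j.1, by omega⟩, ⟨j.1 + 1, by omega⟩, fun U => U j))
    ++ (((List.finRange (n - 1)).filter fun j => j.1 + 1 < n ∧ j.1 + 1 + 1 < n).reverse).map
      (fun j => (⟨j.1, by omega⟩, ⟨j.1 + 1, by omega⟩, fun U => (U j)⁻¹)), ?_, fun U => ?_⟩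
  · intro p hp
    rw [List.mem_append, List.mem_map, List.mem_map] at hp
    obtain ⟨j, -, rfl⟩ | ⟨j, -, rfl⟩ := hp
    · exact continuous_apply j
    · exact (continuous_apply j).inv
  · rw [evalGates, convCircuit, rewindCircuit, convCircuit, List.filter_map,
      ← List.map_reverse, List.map_append, List.map_map, List.map_map, List.map_map]
    rfl

theorem continuous_onPair (a b : Fin n) :
    Continuous fun V : Matrix (Fin q × Fin q) (Fin q × Fin q) ℂ =>
      (onPair a b V : QuditOp q n) := by
  refine continuous_matrix fun u v => ?_
  unfold onPair
  split_ifs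
  · exact continuous_id.matrix_elem _ _
  · exact continuous_const

theorem continuous_siteChannelLin (E : κ → Matrix (Fin q) (Fin q) ℂ) (a : Fin n) :
    Continuous (siteChannelLin E a) := by
  have : (siteChannelLin E a : QuditOp q n → QuditOp q n) =
      fun ρ => ∑ k, onSite a (E k) * ρ * (onSite a (E k))ᴴ := by
    funext ρ
    exact siteChannelLin_apply E a ρ
  rw [this]
  exact continuous_finsetSum _ fun k _ =>
    (continuous_const.matrix_mul continuous_id).matrix_mul continuous_const

theorem continuous_conjLin_onPair {T : Type*} [TopologicalSpace T] (a b : Fin n)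
    {U : T → TwoQuditUnitary q} (hU : Continuous U) {ρ : T → QuditOp q n} (hρ : Continuous ρ) :
    Continuous fun x => conjLin (onPair a b (U x).1) (ρ x) := by
  have h : Continuous fun x => (onPair a b (U x).1 : QuditOp q n) :=
    (continuous_onPair a b).comp (continuous_subtype_val.comp hU)
  exact (h.matrix_mul hρ).matrix_mul h.matrix_conjTranspose

theorem continuous_fullRun {T : Type*} [TopologicalSpace T] (E : κ → Matrix (Fin q) (Fin q) ℂ)
    {C : List (Fin n × Fin n × (T → TwoQuditUnitary q))} (hC : ∀ p ∈ C, Continuous p.2.2)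
    {ρ : T → QuditOp q n} (hρ : Continuous ρ) :
    Continuous fun x => fullRun E (evalGates C x) (ρ x) := by
  induction C generalizing ρ with
  | nil => exact hρ
  | cons p C ih =>
    exact ih (fun p' hp' => hC p' (List.mem_cons_of_mem _ hp'))
      ((continuous_siteChannelLin E _).comp ((continuous_siteChannelLin E _).comp
        (continuous_conjLin_onPair p.1 p.2.1 (hC p List.mem_cons_self) hρ)))

theorem continuous_noisyRunLin {T : Type*} [TopologicalSpace T]
    (E : κ → Matrix (Fin q) (Fin q) ℂ) (i : Fin n)
    {C : List (Fin n × Fin n × (T → TwoQuditUnitary q))} (hC : ∀ p ∈ C, Continuous p.2.2)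
    {ρ : T → QuditOp q n} (hρ : Continuous ρ) :
    Continuous fun x => noisyRunLin E i (evalGates C x) (ρ x) := by
  induction C generalizing ρ with
  | nil => exact hρ
  | cons p C ih =>
    have hn : ∀ x, (∀ h ∈ evalGates C x, h.fst ≠ i ∧ h.snd ≠ i) ↔
        ∀ p ∈ C, p.1 ≠ i ∧ p.2.1 ≠ i := by
      intro x
      rw [evalGates, List.forall_mem_map]
    have hs : ∀ (P : Prop) [Decidable P] (a : Fin n),
        Continuous ((if P then LinearMap.id else siteChannelLin E a) :
          QuditOp q n →ₗ[ℂ] QuditOp q n) := by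
      intro P _ a
      split_ifs
      · exact continuous_id
      · exact continuous_siteChannelLin E a
    have h := ih (fun p' hp' => hC p' (List.mem_cons_of_mem _ hp'))
      ((hs (p.2.1 = i ∧ ∀ p ∈ C, p.1 ≠ i ∧ p.2.1 ≠ i) p.2.1).comp
        ((hs (p.1 = i ∧ ∀ p ∈ C, p.1 ≠ i ∧ p.2.1 ≠ i) p.1).comp
        (continuous_conjLin_onPair p.1 p.2.1 (hC p List.mem_cons_self) hρ)))
    refine h.congr fun x => ?_
    change _ = noisyRunLin E i (⟨p.1, p.2.1, p.2.2 x⟩ :: evalGates C x) (ρ x)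
    rw [noisyRunLin]
    simp only [hn]
    rfl

theorem continuous_trace_mul_fullRun_protocol (E : κ → Matrix (Fin q) (Fin q) ℂ)
    (A ρ : QuditOp q (m + 1)) : Continuous fun U : Fin m → TwoQuditUnitary q =>
      (A * fullRun E (protocol U) ρ).trace := by
  obtain ⟨C, hC, h⟩ := exists_evalGates_eq_circuit (q := q) (n := m + 1)
  have h' : ∀ U : Fin m → TwoQuditUnitary q, protocol U = evalGates C U := fun U => (h U).symm
  simp only [h']
  exact (continuous_const.matrix_mul (continuous_fullRun E hC continuous_const)).matrix_trace

theorem continuous_trace_mul_noisyRunLin_circuit (E : κ → Matrix (Fin q) (Fin q) ℂ) (i : Fin n)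
    (A ρ : QuditOp q n) : Continuous fun U : Fin (n - 1) → TwoQuditUnitary q =>
      (A * noisyRunLin E i (convCircuit U ++ rewindCircuit U) ρ).trace := by
  obtain ⟨C, hC, h⟩ := exists_evalGates_eq_circuit (q := q) (n := n)
  simp only [← h]
  exact (continuous_const.matrix_mul (continuous_noisyRunLin E i hC continuous_const)).matrix_trace

/-- The law of `m` independent Haar-random two-qudit gates. -/
noncomputable def gateMeasure (q m : ℕ) : Measure (Fin m → TwoQuditUnitary q) :=
  Measure.pi fun _ => haarUnitary q

instance gateMeasure.isProbabilityMeasure (q m : ℕ) : IsProbabilityMeasure (gateMeasure q m) :=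
  inferInstanceAs (IsProbabilityMeasure (Measure.pi fun _ => haarUnitary q))

/-- Integration over the first gate, then over the other ones. -/
theorem integral_gateMeasure_succ {f : (Fin (m + 1) → TwoQuditUnitary q) → ℂ}
    (hf : Continuous f) :
    ∫ U, f U ∂(gateMeasure q (m + 1)) =
      ∫ V : Fin m → TwoQuditUnitary q, ∫ U, f (Fin.cons U V) ∂(haarUnitary q)
        ∂(gateMeasure q m) := by
  have hmp := (measurePreserving_piFinSuccAbove
    (fun _ : Fin (m + 1) => haarUnitary q) 0).symm
  have h1 : ∫ U, f U ∂(gateMeasure q (m + 1)) =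
      ∫ p : TwoQuditUnitary q × (Fin m → TwoQuditUnitary q), f (Fin.cons p.1 p.2)
        ∂((haarUnitary q).prod (gateMeasure q m)) := by
    change ∫ U, f U ∂(Measure.pi fun _ : Fin (m + 1) => haarUnitary q) = _
    rw [← hmp.integral_comp (MeasurableEquiv.measurableEmbedding _)]
    refine integral_congr_ae (ae_of_all _ fun p => ?_)
    simp [MeasurableEquiv.piFinSuccAbove, Fin.insertNthEquiv]
  have hc : Continuous fun p : TwoQuditUnitary q × (Fin m → TwoQuditUnitary q) =>
      (Fin.cons p.1 p.2 : Fin (m + 1) → TwoQuditUnitary q) := by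
    refine continuous_pi fun j => ?_
    refine Fin.cases ?_ (fun j => ?_) j
    · simpa using continuous_fst
    · exact (continuous_apply j).comp continuous_snd
  refine h1.trans ?_
  change ∫ p, f (Fin.cons p.1 p.2) ∂((haarUnitary q).prod
    (Measure.pi fun _ : Fin m => haarUnitary q)) = ∫ V, ∫ U, f (Fin.cons U V) ∂(haarUnitary q)
      ∂(Measure.pi fun _ : Fin m => haarUnitary q)
  -- The first gate is the inner variable, so that the Haar moments apply with the other gates
  -- fixed.
  exact integral_prod_symm _ (integrable_of_continuous_compactSpace (hf.comp hc))

end Protocol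

/-! ### Averages of the protocol -/

section Averages

variable {κ : Type*} [Fintype κ] {q m : ℕ}

/-- The Heisenberg dual of the single-qudit channel. -/
def dualChannel (E : κ → Matrix (Fin q) (Fin q) ℂ) (Y : Matrix (Fin q) (Fin q) ℂ) :
    Matrix (Fin q) (Fin q) ℂ :=
  ∑ k, (E k)ᴴ * Y * E k

theorem trace_mul_conjLin {ι : Type*} [Fintype ι] (A B ρ : Matrix ι ι ℂ) :
    (A * conjLin B ρ).trace = (Bᴴ * A * B * ρ).trace := by
  simp only [conjLin, LinearMap.coe_mk, AddHom.coe_mk]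
  rw [← Matrix.mul_assoc, Matrix.trace_mul_comm]
  simp only [Matrix.mul_assoc]

theorem trace_mul_channel (E : κ → Matrix (Fin q) (Fin q) ℂ) (X Y : Matrix (Fin q) (Fin q) ℂ) :
    (Y * channel E X).trace = (dualChannel E Y * X).trace := by
  simp only [channel, LinearMap.sum_apply, Finset.mul_sum, Matrix.trace_sum, trace_mul_conjLin,
    dualChannel, Finset.sum_mul]

theorem dualChannel_one {E : κ → Matrix (Fin q) (Fin q) ℂ} (hE : ∑ k, (E k)ᴴ * E k = 1) :
    dualChannel E 1 = 1 := by
  simpa [dualChannel] using hE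

theorem trace_channel {E : κ → Matrix (Fin q) (Fin q) ℂ} (hE : ∑ k, (E k)ᴴ * E k = 1)
    (X : Matrix (Fin q) (Fin q) ℂ) : (channel E X).trace = X.trace := by
  have h := trace_mul_channel E X 1
  rwa [dualChannel_one hE, Matrix.one_mul, Matrix.one_mul] at h

theorem trace_dualChannel (E : κ → Matrix (Fin q) (Fin q) ℂ) (Y : Matrix (Fin q) (Fin q) ℂ) :
    (dualChannel E Y).trace = (Y * channel E 1).trace := by
  rw [trace_mul_channel, Matrix.mul_one]

theorem trace_tens_mul_siteChannelLin_zero (E : κ → Matrix (Fin q) (Fin q) ℂ)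
    (Y : Matrix (Fin q) (Fin q) ℂ) (B ρ : QuditOp q (m + 1)) (hB : B = tens Y 1) :
    (B * siteChannelLin E 0 ρ).trace = (tens (dualChannel E Y) 1 * ρ).trace := by
  subst hB
  simp only [siteChannelLin, LinearMap.sum_apply, Finset.mul_sum, Matrix.trace_sum,
    trace_mul_conjLin, dualChannel, tens_sum_left, Finset.sum_mul, onSite_zero,
    tens_conjTranspose, tens_mul_tens, Matrix.conjTranspose_one, Matrix.mul_one]

/-- The Kraus operators slide past `A` and meet their adjoints, where trace preservation removes
them. -/
theorem trace_mul_siteChannelLin_of_commute {E : κ → Matrix (Fin q) (Fin q) ℂ} {n : ℕ}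
    {a : Fin n} (h : ∑ k, (onSite a (E k))ᴴ * onSite a (E k) = 1) {A : QuditOp q n}
    (hA : ∀ k, A * onSite a (E k) = onSite a (E k) * A) (ρ : QuditOp q n) :
    (A * siteChannelLin E a ρ).trace = (A * ρ).trace := by
  simp only [siteChannelLin, LinearMap.sum_apply, Finset.mul_sum, Matrix.trace_sum,
    trace_mul_conjLin]
  rw [← Matrix.trace_sum, ← Finset.sum_mul]
  congr 2
  simp only [Matrix.mul_assoc, hA]
  simp only [← Matrix.mul_assoc]
  rw [← Finset.sum_mul, h, Matrix.one_mul]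

theorem sum_onSite_zero {E : κ → Matrix (Fin q) (Fin q) ℂ} (hE : ∑ k, (E k)ᴴ * E k = 1) :
    ∑ k, (onSite (0 : Fin (m + 1)) (E k))ᴴ * onSite 0 (E k) = 1 := by
  simp only [onSite_zero, tens_conjTranspose, tens_mul_tens, ← tens_sum_left, hE,
    Matrix.conjTranspose_one, Matrix.mul_one, tens_one_one]

theorem sum_onSite_one {E : κ → Matrix (Fin q) (Fin q) ℂ} (hE : ∑ k, (E k)ᴴ * E k = 1) :
    ∑ k, (onSite (1 : Fin (m + 2)) (E k))ᴴ * onSite 1 (E k) = 1 := by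
  simp only [onSite_one, tens_conjTranspose, tens_mul_tens, ← tens_sum_left, ← tens_sum_right, hE,
    Matrix.conjTranspose_one, Matrix.mul_one, tens_one_one]

/-- Noise on the second qudit is invisible on the first one. -/
theorem trace_tens_one_mul_siteChannelLin_one {E : κ → Matrix (Fin q) (Fin q) ℂ}
    (hE : ∑ k, (E k)ᴴ * E k = 1) (Y : Matrix (Fin q) (Fin q) ℂ) (ρ : QuditOp q (m + 2)) :
    (tens Y 1 * siteChannelLin E 1 ρ).trace = (tens Y 1 * ρ).trace := by
  refine trace_mul_siteChannelLin_of_commute (sum_onSite_one hE) (fun k => ?_) ρ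
  rw [onSite_one, tens_mul_tens, tens_mul_tens]
  simp

/-- Noise on the first qudit is invisible on the other ones. -/
theorem trace_one_tens_mul_siteChannelLin_zero {E : κ → Matrix (Fin q) (Fin q) ℂ}
    (hE : ∑ k, (E k)ᴴ * E k = 1) (B : QuditOp q m) (ρ : QuditOp q (m + 1)) :
    (tens 1 B * siteChannelLin E 0 ρ).trace = (tens 1 B * ρ).trace := by
  refine trace_mul_siteChannelLin_of_commute (sum_onSite_zero hE) (fun k => ?_) ρ
  rw [onSite_zero, tens_mul_tens, tens_mul_tens]
  simp

theorem conjLin_onPair_tensPair (U : TwoQuditUnitary q)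
    (Z : Matrix (Fin q × Fin q) (Fin q × Fin q) ℂ) (B : QuditOp q m) :
    conjLin (onPair (0 : Fin (m + 2)) 1 U.1) (tensPair Z B) = tensPair (unitaryConj U Z) B := by
  simp only [onPair_zero_one, conjLin, LinearMap.coe_mk, AddHom.coe_mk, tensPair_conjTranspose,
    tensPair_mul_tensPair, unitaryConj, Matrix.conjTranspose_one, Matrix.one_mul, Matrix.mul_one]

/-- Passing to the Heisenberg picture inverts the inverse gate once more, so the observable is
conjugated by $U$ exactly like the input state. -/
theorem trace_tensPair_mul_conjLin_inv (U : TwoQuditUnitary q)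
    (W : Matrix (Fin q × Fin q) (Fin q × Fin q) ℂ) (ρ : QuditOp q (m + 2)) :
    (tensPair W 1 * conjLin (onPair (0 : Fin (m + 2)) 1 (U⁻¹).1) ρ).trace =
      (tensPair (unitaryConj U W) 1 * ρ).trace := by
  have hU : (U⁻¹).1ᴴ = U.1 := by
    exact Matrix.conjTranspose_conjTranspose U.1
  have hU' : (U⁻¹).1 = U.1ᴴ := rfl
  rw [trace_mul_conjLin, onPair_zero_one, tensPair_conjTranspose, hU, hU']
  simp only [tensPair_mul_tensPair, unitaryConj, Matrix.conjTranspose_one, Matrix.mul_one]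

theorem tens_eq_tensPair (Y : Matrix (Fin q) (Fin q) ℂ) :
    tens Y (1 : QuditOp q (m + 1)) = tensPair (Y ⊗ₖ 1) 1 := by
  rw [tensPair_kronecker, tens_one_one]

/-- The inverse gate and its noise in the Heisenberg picture. -/
theorem trace_tens_mul_gateStep_inv {E : κ → Matrix (Fin q) (Fin q) ℂ}
    (hE : ∑ k, (E k)ᴴ * E k = 1) (U : TwoQuditUnitary q) (Y : Matrix (Fin q) (Fin q) ℂ)
    (ρ : QuditOp q (m + 2)) :
    (tens Y 1 * gateStep E ⟨0, 1, U⁻¹⟩ ρ).trace =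
      (tensPair (unitaryConj U (dualChannel E Y ⊗ₖ 1)) 1 * ρ).trace := by
  rw [gateStep, LinearMap.comp_apply, LinearMap.comp_apply,
    trace_tens_one_mul_siteChannelLin_one hE, trace_tens_mul_siteChannelLin_zero E Y _ _ rfl,
    tens_eq_tensPair, trace_tensPair_mul_conjLin_inv]

/-- A gate on the first two qudits is invisible on the other ones. -/
theorem trace_tensPair_one_mul_gateStep {E : κ → Matrix (Fin q) (Fin q) ℂ}
    (hE : ∑ k, (E k)ᴴ * E k = 1) (U : TwoQuditUnitary q) (B : QuditOp q m)
    (ρ : QuditOp q (m + 2)) :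
    (tens 1 (tens 1 B) * gateStep E ⟨0, 1, U⟩ ρ).trace = (tens 1 (tens 1 B) * ρ).trace := by
  have hU : U.1ᴴ * U.1 = 1 := Matrix.mem_unitaryGroup_iff'.mp U.2
  rw [gateStep, LinearMap.comp_apply, LinearMap.comp_apply,
    trace_mul_siteChannelLin_of_commute (sum_onSite_one hE) (fun k => ?_),
    trace_one_tens_mul_siteChannelLin_zero hE, trace_mul_conjLin, ← tensPair_kronecker,
    onPair_zero_one, tensPair_conjTranspose]
  · simp only [tensPair_mul_tensPair, Matrix.one_kronecker_one, Matrix.mul_one, hU,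
      Matrix.conjTranspose_one, Matrix.one_mul]
  · rw [onSite_one]
    simp only [tens_mul_tens, Matrix.one_mul, Matrix.mul_one]

/-- The noise on the first two qudits. -/
def pairNoise (E : κ → Matrix (Fin q) (Fin q) ℂ) : QuditOp q (m + 2) →ₗ[ℂ] QuditOp q (m + 2) :=
  siteChannelLin E 1 ∘ₗ siteChannelLin E 0

theorem pairNoise_tens (E : κ → Matrix (Fin q) (Fin q) ℂ) (A B : Matrix (Fin q) (Fin q) ℂ)
    (C : QuditOp q m) :
    pairNoise E (tens A (tens B C)) = tens (channel E A) (tens (channel E B) C) := by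
  rw [pairNoise, LinearMap.comp_apply, siteChannelLin_zero_tens, siteChannelLin_one_tens]

theorem gateStep_tensPair (E : κ → Matrix (Fin q) (Fin q) ℂ) (U : TwoQuditUnitary q)
    (Z : Matrix (Fin q × Fin q) (Fin q × Fin q) ℂ) (B : QuditOp q m) :
    gateStep E ⟨0, 1, U⟩ (tensPair Z B) = pairNoise E (tensPair (unitaryConj U Z) B) := by
  rw [gateStep, LinearMap.comp_apply, LinearMap.comp_apply, conjLin_onPair_tensPair]
  rfl

theorem single_eq_kronecker (i j : Fin q × Fin q) :
    Matrix.single i j (1 : ℂ) = Matrix.single i.1 j.1 1 ⊗ₖ Matrix.single i.2 j.2 1 := by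
  rw [Matrix.kroneckerMap_single_single _ _ _ _ _ (by simp) (by simp), mul_one]

/-- The left side is the trace of the channel as a linear map on matrices. Each summand $\rho\mapsto
E\rho E^\dagger$ has trace $|\mathrm{Tr}\,E|^2$. -/
theorem sum_trace_single_mul_channel {κ : Type*} [Fintype κ]
    (E : κ → Matrix (Fin q) (Fin q) ℂ) :
    ∑ a, ∑ c, (Matrix.single c a 1 * channel E (Matrix.single a c 1)).trace =
      ((∑ k, ‖(E k).trace‖ ^ 2 : ℝ) : ℂ) := by
  have h : ∀ a c, (Matrix.single c a 1 * channel E (Matrix.single a c 1)).trace =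
      ∑ k, E k a a * star (E k c c) := by
    intro a c
    rw [channel_apply, Finset.mul_sum, Matrix.trace_sum]
    refine Finset.sum_congr rfl fun k _ => ?_
    rw [← Matrix.mul_assoc, ← Matrix.mul_assoc, Matrix.single_mul_mul_single]
    simp [Matrix.trace_mul_comm (Matrix.single _ _ _), Matrix.trace_mul_single, mul_comm]
  simp only [h]
  have h2 : ∀ k, ∑ a, ∑ c, E k a a * star (E k c c) = ((‖(E k).trace‖ ^ 2 : ℝ) : ℂ) := by
    intro k
    rw [← Finset.sum_mul_sum, ← star_sum]
    have := Complex.mul_conj' ((E k).trace)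
    push_cast
    exact this
  rw [Complex.ofReal_sum]
  simp only [← h2]
  rw [Finset.sum_comm (s := (Finset.univ : Finset κ))]
  exact Finset.sum_congr rfl fun a _ => Finset.sum_comm

/-- The products $E_kE_l$ are Kraus operators of $\Phi^2$, so $\beta$ is to $\Phi^2$ what $\alpha$
is to $\Phi$. -/
theorem channel_channel (E : κ → Matrix (Fin q) (Fin q) ℂ) (X : Matrix (Fin q) (Fin q) ℂ) :
    channel E (channel E X) = channel (fun p : κ × κ => E p.1 * E p.2) X := by
  rw [channel_apply, channel_apply, channel_apply, Fintype.sum_prod_type]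
  refine Finset.sum_congr rfl fun k _ => ?_
  rw [Finset.mul_sum, Finset.sum_mul]
  refine Finset.sum_congr rfl fun l _ => ?_
  simp only [Matrix.conjTranspose_mul, Matrix.mul_assoc]

theorem natCast_pow_four_sub_one_ne_zero (hq : 2 ≤ q) : (q : ℂ) ^ 4 - 1 ≠ 0 := by
  have h1 : 1 < q ^ 4 := Nat.one_lt_pow (by norm_num) (by omega)
  have h2 : (q : ℂ) ^ 4 ≠ 1 := by exact_mod_cast h1.ne'
  exact sub_ne_zero.mpr h2

variable [NeZero q]

/-- The expectation of `Y` on the first qudit after a run from `X ⊗ |0…0⟩⟨0…0|`. -/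
def siteForm (E : κ → Matrix (Fin q) (Fin q) ℂ) (C : List (Gate q (m + 1)))
    (X Y : Matrix (Fin q) (Fin q) ℂ) : ℂ :=
  (tens Y 1 * fullRun E C (tens X (initialState q m))).trace

/-- The expectation of `W` on the first two qudits after the noise and a run on all qudits but the
first, from `Z ⊗ |0…0⟩⟨0…0|`. -/
def pairForm (E : κ → Matrix (Fin q) (Fin q) ℂ) (C : List (Gate q (m + 1))) :
    Matrix (Fin q × Fin q) (Fin q × Fin q) ℂ →ₗ[ℂ]
      Matrix (Fin q × Fin q) (Fin q × Fin q) ℂ →ₗ[ℂ] ℂ :=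
  LinearMap.mk₂ ℂ (fun Z W => (tensPair W 1 *
    fullRun E (C.map Gate.shift) (pairNoise E (tensPair Z (initialState q m)))).trace)
    (by intro Z Z' W
        rw [tensPair_add_left, map_add, map_add, Matrix.mul_add, Matrix.trace_add])
    (by intro c Z W
        rw [tensPair_smul_left, map_smul, map_smul, Matrix.mul_smul, Matrix.trace_smul])
    (by intro Z W W'
        rw [tensPair_add_left, Matrix.add_mul, Matrix.trace_add])
    (by intro c Z W
        rw [tensPair_smul_left, Matrix.smul_mul, Matrix.trace_smul])

theorem pairForm_apply (E : κ → Matrix (Fin q) (Fin q) ℂ) (C : List (Gate q (m + 1)))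
    (Z W : Matrix (Fin q × Fin q) (Fin q × Fin q) ℂ) :
    pairForm E C Z W = (tensPair W 1 *
      fullRun E (C.map Gate.shift) (pairNoise E (tensPair Z (initialState q m)))).trace := rfl

theorem pairForm_kronecker (E : κ → Matrix (Fin q) (Fin q) ℂ) (C : List (Gate q (m + 1)))
    (A B A' B' : Matrix (Fin q) (Fin q) ℂ) :
    pairForm E C (A ⊗ₖ B) (A' ⊗ₖ B') =
      (A' * channel E A).trace * siteForm E C (channel E B) B' := by
  rw [pairForm_apply, tensPair_kronecker, tensPair_kronecker, pairNoise_tens, fullRun_shift,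
    tens_mul_tens, trace_tens]
  rfl

theorem natCast_ne_zero_of_neZero : (q : ℂ) ≠ 0 := by
  exact_mod_cast NeZero.ne q

theorem sum_trace_channel_eq_krausAlpha (E : κ → Matrix (Fin q) (Fin q) ℂ) :
    ∑ a, ∑ c, (Matrix.single c a 1 * channel E (Matrix.single a c 1)).trace =
      (krausAlpha E : ℂ) * (q : ℂ) ^ 2 := by
  have hq := natCast_ne_zero_of_neZero (q := q)
  rw [sum_trace_single_mul_channel, krausAlpha]
  push_cast
  field_simp

theorem sum_trace_channel_channel_eq_krausBeta (E : κ → Matrix (Fin q) (Fin q) ℂ) :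
    ∑ a, ∑ c, (Matrix.single c a 1 * channel E (channel E (Matrix.single a c 1))).trace =
      (krausBeta E : ℂ) * (q : ℂ) ^ 2 := by
  have hq := natCast_ne_zero_of_neZero (q := q)
  simp only [channel_channel]
  rw [sum_trace_single_mul_channel, krausBeta, Fintype.sum_prod_type]
  push_cast
  field_simp

theorem pairForm_one_one {E : κ → Matrix (Fin q) (Fin q) ℂ} (hE : ∑ k, (E k)ᴴ * E k = 1)
    (C : List (Gate q (m + 1))) : pairForm E C 1 1 = q * siteForm E C (channel E 1) 1 := by
  rw [← Matrix.one_kronecker_one, pairForm_kronecker, Matrix.one_mul, trace_channel hE]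
  simp

/-- The swap tensor $\sum E_{ij}\otimes E_{ji}$ is a product over the two qudits, and the first of
them only meets $\Phi$ between the two outer gates. -/
theorem sum_pairForm_single (E : κ → Matrix (Fin q) (Fin q) ℂ) (C : List (Gate q (m + 1))) :
    ∑ i, ∑ j, pairForm E C (Matrix.single i j 1) (Matrix.single j i 1) =
      (krausAlpha E : ℂ) * (q : ℂ) ^ 2 *
        ∑ b, ∑ d, siteForm E C (channel E (Matrix.single b d 1)) (Matrix.single d b 1) := by
  simp only [single_eq_kronecker, pairForm_kronecker, Fintype.sum_prod_type]
  rw [← sum_trace_channel_eq_krausAlpha, Finset.sum_mul]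
  refine Finset.sum_congr rfl fun a _ => ?_
  rw [Finset.sum_mul, Finset.sum_comm]
  refine Finset.sum_congr rfl fun c _ => ?_
  rw [Finset.mul_sum]
  refine Finset.sum_congr rfl fun b _ => ?_
  rw [Finset.mul_sum]

theorem fullRun_protocol_cons (E : κ → Matrix (Fin q) (Fin q) ℂ) (U : TwoQuditUnitary q)
    (V : Fin (m + 1) → TwoQuditUnitary q) (X : Matrix (Fin q) (Fin q) ℂ) :
    fullRun E ((⟨0, 1, U⟩ : Gate q (m + 3)) :: (protocol V).map Gate.shift)
      (tens X (initialState q (m + 2))) =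
    fullRun E ((protocol V).map Gate.shift) (pairNoise E
      (tensPair (unitaryConj U (X ⊗ₖ ketBraZero q)) (initialState q (m + 1)))) := by
  rw [fullRun_cons, initialState_succ (m := m + 1), ← tensPair_kronecker, gateStep_tensPair]

theorem siteForm_protocol_cons {E : κ → Matrix (Fin q) (Fin q) ℂ}
    (hE : ∑ k, (E k)ᴴ * E k = 1) (U : TwoQuditUnitary q) (V : Fin (m + 1) → TwoQuditUnitary q)
    (X Y : Matrix (Fin q) (Fin q) ℂ) :
    siteForm E (protocol (Fin.cons U V : Fin (m + 2) → TwoQuditUnitary q)) X Y =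
      pairForm E (protocol V) (unitaryConj U (X ⊗ₖ ketBraZero q))
        (unitaryConj U (dualChannel E Y ⊗ₖ 1)) := by
  rw [siteForm, protocol_cons, fullRun_append, fullRun_protocol_cons, fullRun_cons]
  exact trace_tens_mul_gateStep_inv hE U Y _

theorem continuous_siteForm (E : κ → Matrix (Fin q) (Fin q) ℂ) (X Y : Matrix (Fin q) (Fin q) ℂ) :
    Continuous fun V : Fin m → TwoQuditUnitary q =>
      siteForm E (protocol V) X Y :=
  continuous_trace_mul_fullRun_protocol E (tens Y 1) (tens X (initialState q m))

theorem integrable_siteForm (E : κ → Matrix (Fin q) (Fin q) ℂ) (X Y : Matrix (Fin q) (Fin q) ℂ) :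
    Integrable (fun V : Fin m → TwoQuditUnitary q => siteForm E (protocol V) X Y)
      (gateMeasure q m) :=
  integrable_of_continuous_compactSpace (continuous_siteForm E X Y)

/-- The weight of the identity in the average of the noisy protocol on `m + 2` qudits. -/
noncomputable def identityWeight (E : κ → Matrix (Fin q) (Fin q) ℂ) : ℕ → ℝ
  | 0 => 0
  | m + 1 => (krausAlpha E * (q : ℝ) ^ 2 * (1 + identityWeight E m * (krausBeta E * (q : ℝ) ^ 2 - 1))
      - 1) / ((q : ℝ) ^ 4 - 1)

theorem trace_initialState : (initialState q m).trace = 1 := by simp [initialState]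

theorem trace_ketBraZero : (ketBraZero q).trace = 1 := by simp [ketBraZero]

/-- The average over the outermost gate, given the average over the other ones. -/
theorem integral_pairForm (hq : 2 ≤ q) {E : κ → Matrix (Fin q) (Fin q) ℂ}
    (hE : ∑ k, (E k)ᴴ * E k = 1)
    (h : ∀ X Y, ∫ V : Fin (m + 1) → TwoQuditUnitary q,
      siteForm E (protocol V) X Y ∂(gateMeasure q (m + 1)) =
        identityWeight E m * (Y * channel E X).trace +
          (1 - identityWeight E m) * (X.trace * (Y * channel E 1).trace) / q)
    (Z W : Matrix (Fin q × Fin q) (Fin q × Fin q) ℂ) :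
    ∫ V : Fin (m + 1) → TwoQuditUnitary q, ∫ U, pairForm E (protocol V)
      (unitaryConj U Z) (unitaryConj U W) ∂(haarUnitary q) ∂(gateMeasure q (m + 1)) =
      identityWeight E (m + 1) * (Z * W).trace +
        (1 - identityWeight E (m + 1)) * (Z.trace * W.trace) / (q : ℂ) ^ 2 := by
  have hq0 := natCast_ne_zero_of_neZero (q := q)
  have hq4 := natCast_pow_four_sub_one_ne_zero hq
  simp only [integral_haarUnitary_bilinear hq, pairForm_one_one hE, sum_pairForm_single]
  have hi := fun X Y => integrable_siteForm (m := m + 1) E X Y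
  have e1 : ∫ V : Fin (m + 1) → TwoQuditUnitary q,
      siteForm E (protocol V) (channel E 1) 1 ∂(gateMeasure q (m + 1)) = q := by
    rw [h]
    simp only [Matrix.one_mul, trace_channel hE, Matrix.trace_one, Fintype.card_fin]
    field_simp
    ring
  -- One $\Phi$ follows the outer gate and another one sits in the induction hypothesis. The
  -- identity part thus yields the trace $\beta q^2$ of $\Phi^2$, the depolarising part yields 1.
  have e2 : ∫ V : Fin (m + 1) → TwoQuditUnitary q,
      ∑ b, ∑ d, siteForm E (protocol V) (channel E (Matrix.single b d 1))
        (Matrix.single d b 1) ∂(gateMeasure q (m + 1)) =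
      1 + identityWeight E m * (krausBeta E * (q : ℂ) ^ 2 - 1) := by
    rw [integral_finsetSum _ fun b _ => integrable_finsetSum _ fun d _ => hi _ _]
    simp only [integral_finsetSum _ fun d _ => hi _ _, h, Finset.sum_add_distrib,
      ← Finset.mul_sum, ← Finset.sum_div, sum_trace_channel_channel_eq_krausBeta,
      trace_channel hE]
    have e3 : ∑ b : Fin q, ∑ d : Fin q, (Matrix.single b d (1 : ℂ)).trace *
        (Matrix.single d b 1 * channel E 1).trace = q := by
      have : ∀ b d : Fin q, (Matrix.single b d (1 : ℂ)).trace *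
          (Matrix.single d b 1 * channel E 1).trace =
            if b = d then channel E 1 b b else 0 := by
        intro b d
        by_cases hbd : b = d
        · subst hbd
          simp [Matrix.trace_mul_comm (Matrix.single _ _ _), Matrix.trace_mul_single]
        · simp [Matrix.trace_single_eq_of_ne _ _ _ hbd, hbd]
      simp only [this, Finset.sum_ite_eq, Finset.mem_univ, if_true]
      have h2 := trace_channel hE 1
      rw [Matrix.trace_one, Fintype.card_fin] at h2
      exact h2
    rw [e3]
    field_simp
    ring
  have hs : Integrable (fun V : Fin (m + 1) → TwoQuditUnitary q =>
      ∑ b, ∑ d, siteForm E (protocol V) (channel E (Matrix.single b d 1))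
        (Matrix.single d b 1)) (gateMeasure q (m + 1)) :=
    integrable_finsetSum _ fun b _ => integrable_finsetSum _ fun d _ => hi _ _
  rw [integral_div, integral_add (((hi _ _).const_mul _).const_mul _)
    ((hs.const_mul _).const_mul _), integral_const_mul, integral_const_mul, integral_const_mul,
    integral_const_mul, e1, e2, identityWeight]
  push_cast
  field_simp
  ring

/-- The averaged protocol acts on its first qudit as
$\Phi\circ\big(w\,\mathrm{id}+(1-w)\,\mathrm{Tr}(\cdot)\,1/q\big)$. This form is stable under adding
an outer gate. With two qudits nothing is rewound, so the single random gate depolarises completely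
and $w=0$. -/
theorem integral_siteForm (hq : 2 ≤ q) {E : κ → Matrix (Fin q) (Fin q) ℂ}
    (hE : ∑ k, (E k)ᴴ * E k = 1) (m : ℕ) (X Y : Matrix (Fin q) (Fin q) ℂ) :
    ∫ V : Fin (m + 1) → TwoQuditUnitary q,
      siteForm E (protocol V) X Y ∂(gateMeasure q (m + 1)) =
        identityWeight E m * (Y * channel E X).trace +
          (1 - identityWeight E m) * (X.trace * (Y * channel E 1).trace) / q := by
  have hq0 := natCast_ne_zero_of_neZero (q := q)
  induction m generalizing X Y with
  | zero =>
    rw [integral_gateMeasure_succ (m := 0) (continuous_siteForm E X Y)]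
    let ℓ : Matrix (Fin q × Fin q) (Fin q × Fin q) ℂ →ₗ[ℂ] ℂ :=
      Matrix.traceLinearMap _ ℂ ℂ ∘ₗ LinearMap.mulLeft ℂ (dualChannel E Y ⊗ₖ 1)
    have h : ∀ (U : TwoQuditUnitary q) (V : Fin 0 → TwoQuditUnitary q),
        siteForm E (protocol (Fin.cons U V : Fin 1 → TwoQuditUnitary q)) X Y =
          ℓ (unitaryConj U (X ⊗ₖ ketBraZero q)) := by
      intro U V
      rw [siteForm, protocol_two, fullRun_cons, initialState_succ (m := 0), ← tensPair_kronecker]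
      change (_ * gateStep E _ _).trace = _
      rw [gateStep, LinearMap.comp_apply, LinearMap.comp_apply,
        trace_tens_one_mul_siteChannelLin_one hE, trace_tens_mul_siteChannelLin_zero E Y _ _ rfl,
        conjLin_onPair_tensPair, tens_eq_tensPair, tensPair_mul_tensPair, trace_tensPair,
        Matrix.one_mul, trace_initialState, mul_one]
      rfl
    simp only [h, integral_haarUnitary_linear hq]
    rw [integral_const]
    simp [ℓ, identityWeight, Matrix.trace_kronecker, trace_ketBraZero, trace_dualChannel]
    field_simp
  | succ m ih =>
    rw [integral_gateMeasure_succ (m := m + 1) (continuous_siteForm E X Y)]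
    simp only [siteForm_protocol_cons hE]
    rw [integral_pairForm hq hE ih]
    simp only [← Matrix.mul_kronecker_mul, Matrix.trace_kronecker, Matrix.mul_one,
      trace_ketBraZero, Matrix.trace_one, Fintype.card_fin, trace_dualChannel]
    -- The noise after $U^\dagger$ was moved onto $Y$; duality moves it back to give
    -- $\mathrm{Tr}(Y\Phi(X))$.
    rw [Matrix.trace_mul_comm X, ← trace_mul_channel]
    field_simp

end Averages

/-! ### Fidelity of each qudit, with the noise before its read-out omitted. -/

section Readout

variable {κ : Type*} [Fintype κ] {q m : ℕ}

/-- The noise on the read-out qudit is omitted and the noise on its partner is invisible, so the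
bare observable $Y$ appears where `trace_tens_mul_gateStep_inv` has $\Phi^*(Y)$. -/
theorem trace_onSite_zero_mul_noisyRunLin {E : κ → Matrix (Fin q) (Fin q) ℂ}
    (hE : ∑ k, (E k)ᴴ * E k = 1) (U : TwoQuditUnitary q) (Y : Matrix (Fin q) (Fin q) ℂ)
    (ρ : QuditOp q (m + 2)) :
    (onSite 0 Y * noisyRunLin E 0 [⟨0, 1, U⟩] ρ).trace =
      (tensPair (Y ⊗ₖ 1) 1 * conjLin (onPair 0 1 U.1) ρ).trace := by
  have h : noisyRunLin E 0 [(⟨0, 1, U⟩ : Gate q (m + 2))] ρ =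
      siteChannelLin E 1 (conjLin (onPair 0 1 U.1) ρ) := by
    simp [noisyRunLin]
  rw [h, onSite_zero, trace_tens_one_mul_siteChannelLin_one hE, tens_eq_tensPair]

theorem trace_onSite_one_mul_noisyRunLin {E : κ → Matrix (Fin q) (Fin q) ℂ}
    (hE : ∑ k, (E k)ᴴ * E k = 1) (U : TwoQuditUnitary q) (Y : Matrix (Fin q) (Fin q) ℂ)
    (ρ : QuditOp q (m + 2)) :
    (onSite 1 Y * noisyRunLin E 1 [⟨0, 1, U⟩] ρ).trace =
      (tensPair (1 ⊗ₖ Y) 1 * conjLin (onPair 0 1 U.1) ρ).trace := by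
  have h : noisyRunLin E 1 [(⟨0, 1, U⟩ : Gate q (m + 2))] ρ =
      siteChannelLin E 0 (conjLin (onPair 0 1 U.1) ρ) := by
    simp [noisyRunLin]
  rw [h, onSite_one, trace_one_tens_mul_siteChannelLin_zero hE, tensPair_kronecker]

variable [NeZero q]

/-- The expectation of `|0⟩⟨0|` on qudit `i` after the noisy run from `X ⊗ |0…0⟩⟨0…0|`. -/
def readout (E : κ → Matrix (Fin q) (Fin q) ℂ) (i : Fin (m + 1)) (C : List (Gate q (m + 1)))
    (X : Matrix (Fin q) (Fin q) ℂ) : ℂ :=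
  (onSite i (ketBraZero q) * noisyRunLin E i C (tens X (initialState q m))).trace

theorem readout_zero_protocol_cons {E : κ → Matrix (Fin q) (Fin q) ℂ}
    (hE : ∑ k, (E k)ᴴ * E k = 1) (U : TwoQuditUnitary q) (V : Fin (m + 1) → TwoQuditUnitary q)
    (X : Matrix (Fin q) (Fin q) ℂ) :
    readout E 0 (protocol (Fin.cons U V : Fin (m + 2) → TwoQuditUnitary q)) X =
      pairForm E (protocol V) (unitaryConj U (X ⊗ₖ ketBraZero q))
        (unitaryConj U (ketBraZero q ⊗ₖ 1)) := by
  rw [readout, protocol_cons, noisyRunLin_append_of_touched E _ (by simp),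
    fullRun_protocol_cons, trace_onSite_zero_mul_noisyRunLin hE, trace_tensPair_mul_conjLin_inv]
  rfl

theorem readout_one_protocol_cons {E : κ → Matrix (Fin q) (Fin q) ℂ}
    (hE : ∑ k, (E k)ᴴ * E k = 1) (U : TwoQuditUnitary q) (V : Fin (m + 1) → TwoQuditUnitary q)
    (X : Matrix (Fin q) (Fin q) ℂ) :
    readout E 1 (protocol (Fin.cons U V : Fin (m + 2) → TwoQuditUnitary q)) X =
      pairForm E (protocol V) (unitaryConj U (X ⊗ₖ ketBraZero q))
        (unitaryConj U (1 ⊗ₖ ketBraZero q)) := by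
  rw [readout, protocol_cons, noisyRunLin_append_of_touched E _ (by simp),
    fullRun_protocol_cons, trace_onSite_one_mul_noisyRunLin hE, trace_tensPair_mul_conjLin_inv]
  rfl

/-- The expectation of `|0⟩⟨0|` on qudit `i + 1` after the noise on the first two qudits and a run
on all qudits but the first, from `Z ⊗ |0…0⟩⟨0…0|`. -/
def tailForm (E : κ → Matrix (Fin q) (Fin q) ℂ) (i : Fin (m + 1)) (C : List (Gate q (m + 1))) :
    Matrix (Fin q × Fin q) (Fin q × Fin q) ℂ →ₗ[ℂ] ℂ where
  toFun Z := (tens 1 (onSite i (ketBraZero q)) * noisyRunLin E i.succ (C.map Gate.shift)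
    (pairNoise E (tensPair Z (initialState q m)))).trace
  map_add' Z Z' := by
    rw [tensPair_add_left, map_add, map_add, Matrix.mul_add, Matrix.trace_add]
  map_smul' c Z := by
    rw [tensPair_smul_left, map_smul, map_smul, Matrix.mul_smul, Matrix.trace_smul]
    rfl

theorem tailForm_one {E : κ → Matrix (Fin q) (Fin q) ℂ} (hE : ∑ k, (E k)ᴴ * E k = 1)
    (i : Fin (m + 1)) (C : List (Gate q (m + 1))) :
    tailForm E i C 1 = q * readout E i C (channel E 1) := by
  change (_ * noisyRunLin E i.succ _ (pairNoise E (tensPair 1 _))).trace = _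
  rw [← Matrix.one_kronecker_one, tensPair_kronecker, pairNoise_tens, noisyRunLin_shift,
    tens_mul_tens, trace_tens, Matrix.one_mul, trace_channel hE, Matrix.trace_one,
    Fintype.card_fin]
  rfl

/-- The outer inverse gate does not touch the qudit, and by trace preservation its noise is
invisible too. The dependence on $U$ becomes linear, so the first moment suffices. -/
theorem readout_succ_succ_protocol_cons {E : κ → Matrix (Fin q) (Fin q) ℂ}
    (hE : ∑ k, (E k)ᴴ * E k = 1) (i : Fin (m + 1)) (U : TwoQuditUnitary q)
    (V : Fin (m + 1) → TwoQuditUnitary q) (X : Matrix (Fin q) (Fin q) ℂ) :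
    readout E i.succ.succ (protocol (Fin.cons U V : Fin (m + 2) → TwoQuditUnitary q)) X =
      tailForm E i.succ (protocol V) (unitaryConj U (X ⊗ₖ ketBraZero q)) := by
  have h0 : (0 : Fin (m + 3)) ≠ i.succ.succ := (Fin.succ_ne_zero _).symm
  have h1 : (1 : Fin (m + 3)) ≠ i.succ.succ := fun h =>
    Fin.succ_ne_zero i (Fin.succ_injective _ (show Fin.succ 0 = i.succ.succ from h)).symm
  rw [readout, protocol_cons, noisyRunLin_append_of_untouched E _ (by simp [h0, h1]),
    noisyRunLin_cons_of_pos E _ _ (Or.inl ⟨h0, h1⟩), initialState_succ (m := m + 1),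
    ← tensPair_kronecker, gateStep_tensPair, onSite_succ, onSite_succ]
  change (_ * gateStep E _ _).trace = _
  rw [trace_tensPair_one_mul_gateStep hE, ← onSite_succ]
  rfl

theorem continuous_readout (E : κ → Matrix (Fin q) (Fin q) ℂ) (i : Fin (m + 1))
    (X : Matrix (Fin q) (Fin q) ℂ) :
    Continuous fun V : Fin m → TwoQuditUnitary q => readout E i (protocol V) X :=
  continuous_trace_mul_noisyRunLin_circuit (n := m + 1) E i _ _

theorem integral_readout_zero (hq : 2 ≤ q) {E : κ → Matrix (Fin q) (Fin q) ℂ}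
    (hE : ∑ k, (E k)ᴴ * E k = 1) (m : ℕ) :
    ∫ V : Fin (m + 1) → TwoQuditUnitary q, readout E 0 (protocol V) (ketBraZero q)
      ∂(gateMeasure q (m + 1)) = identityWeight E m + (1 - identityWeight E m) / q := by
  have hq0 := natCast_ne_zero_of_neZero (q := q)
  rw [integral_gateMeasure_succ (continuous_readout E 0 _)]
  cases m with
  | zero =>
    let ℓ : Matrix (Fin q × Fin q) (Fin q × Fin q) ℂ →ₗ[ℂ] ℂ :=
      Matrix.traceLinearMap _ ℂ ℂ ∘ₗ LinearMap.mulLeft ℂ (ketBraZero q ⊗ₖ 1)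
    have h : ∀ (U : TwoQuditUnitary q) (V : Fin 0 → TwoQuditUnitary q),
        readout E 0 (protocol (Fin.cons U V : Fin 1 → TwoQuditUnitary q)) (ketBraZero q) =
          ℓ (unitaryConj U (ketBraZero q ⊗ₖ ketBraZero q)) := by
      intro U V
      rw [readout, protocol_two, initialState_succ (m := 0), ← tensPair_kronecker,
        trace_onSite_zero_mul_noisyRunLin hE, conjLin_onPair_tensPair, tensPair_mul_tensPair,
        trace_tensPair, Matrix.one_mul, trace_initialState, mul_one]
      rfl
    simp only [h, integral_haarUnitary_linear hq]
    rw [integral_const]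
    simp [ℓ, identityWeight, Matrix.trace_kronecker, trace_ketBraZero]
    field_simp
  | succ m =>
    simp only [readout_zero_protocol_cons hE]
    rw [integral_pairForm hq hE (integral_siteForm hq hE m)]
    have hk : ketBraZero q * ketBraZero q = ketBraZero q := by simp [ketBraZero]
    simp only [← Matrix.mul_kronecker_mul, Matrix.trace_kronecker, Matrix.mul_one, hk,
      trace_ketBraZero, Matrix.trace_one, Fintype.card_fin]
    field_simp

theorem integral_readout_one (hq : 2 ≤ q) {E : κ → Matrix (Fin q) (Fin q) ℂ}
    (hE : ∑ k, (E k)ᴴ * E k = 1) (m : ℕ) (X : Matrix (Fin q) (Fin q) ℂ) :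
    ∫ V : Fin (m + 2) → TwoQuditUnitary q, readout E 1 (protocol V) X ∂(gateMeasure q (m + 2)) =
      X.trace * (identityWeight E (m + 1) + (1 - identityWeight E (m + 1)) / q) := by
  have hq0 := natCast_ne_zero_of_neZero (q := q)
  have hk : ketBraZero q * ketBraZero q = ketBraZero q := by simp [ketBraZero]
  rw [integral_gateMeasure_succ (continuous_readout E 1 _)]
  simp only [readout_one_protocol_cons hE]
  rw [integral_pairForm hq hE (integral_siteForm hq hE m)]
  simp only [← Matrix.mul_kronecker_mul, Matrix.trace_kronecker, Matrix.mul_one, hk,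
    trace_ketBraZero, Matrix.trace_one, Fintype.card_fin]
  field_simp

/-- Here `i` counts from zero, and `him` excludes the last qudit, which is not rewound. -/
theorem integral_readout_of_pos (hq : 2 ≤ q) {E : κ → Matrix (Fin q) (Fin q) ℂ}
    (hE : ∑ k, (E k)ᴴ * E k = 1) (m i : ℕ) (hi : 1 ≤ i) (him : i ≤ m + 1)
    (X : Matrix (Fin q) (Fin q) ℂ) :
    ∫ V : Fin (m + 2) → TwoQuditUnitary q, readout E ⟨i, by omega⟩ (protocol V) X
      ∂(gateMeasure q (m + 2)) =
      X.trace * (identityWeight E (m + 2 - i) + (1 - identityWeight E (m + 2 - i)) / q) := by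
  have hq0 := natCast_ne_zero_of_neZero (q := q)
  induction m generalizing i X with
  | zero =>
    obtain rfl : i = 1 := by omega
    exact integral_readout_one hq hE 0 X
  | succ m ih =>
    obtain rfl | ⟨j, rfl⟩ : i = 1 ∨ ∃ j, i = j + 2 := by
      rcases Nat.lt_or_ge i 2 with h | h
      · left; omega
      · exact Or.inr ⟨i - 2, by omega⟩
    · exact integral_readout_one hq hE (m + 1) X
    · have hj : j < m + 2 := by omega
      have e : (⟨j + 2, by omega⟩ : Fin (m + 1 + 2 + 1)) = (⟨j, hj⟩ : Fin (m + 2)).succ.succ := rfl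
      rw [e, integral_gateMeasure_succ (continuous_readout E _ _)]
      simp only [readout_succ_succ_protocol_cons hE, integral_haarUnitary_linear hq,
        tailForm_one hE]
      -- After averaging over the outer gate the inner protocol starts from $\Phi(1)$ instead of
      -- $|0\rangle\langle0|$, which is why the induction runs over all `X`.
      have h := ih (j + 1) (by omega) (by omega) (channel E 1)
      have e' : (⟨j + 1, by omega⟩ : Fin (m + 2 + 1)) = (⟨j, hj⟩ : Fin (m + 2)).succ := rfl
      rw [e', show m + 2 - (j + 1) = m + 1 + 2 - (j + 2) by omega] at h
      rw [integral_div, integral_const_mul, integral_const_mul, h, trace_channel hE,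
        Matrix.trace_kronecker, trace_ketBraZero, Matrix.trace_one, Fintype.card_fin]
      field_simp

theorem resetFidelity_eq_readout (E : κ → Matrix (Fin q) (Fin q) ℂ) (i : Fin (m + 1))
    (U : Fin m → TwoQuditUnitary q) :
    resetFidelity E (m + 1) i U = (readout E i (protocol U) (ketBraZero q)).re := by
  rw [resetFidelity, readout, noisyRunLin_apply, initialState_succ]
  rfl

theorem averagedFidelity_eq_re_integral (E : κ → Matrix (Fin q) (Fin q) ℂ) (i : Fin (m + 1)) :
    averagedFidelity E (m + 1) i =
      (∫ V : Fin m → TwoQuditUnitary q, readout E i (protocol V) (ketBraZero q)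
        ∂(gateMeasure q m)).re := by
  have h : ∫ V : Fin m → TwoQuditUnitary q,
      RCLike.re (readout E i (protocol V) (ketBraZero q)) ∂(gateMeasure q m) =
        RCLike.re (∫ V : Fin m → TwoQuditUnitary q, readout E i (protocol V) (ketBraZero q)
          ∂(gateMeasure q m)) :=
    integral_re (integrable_of_continuous_compactSpace (continuous_readout E i _))
  refine Eq.trans ?_ h
  exact integral_congr_ae (ae_of_all _ fun U => resetFidelity_eq_readout E i U)

theorem integrable_resetFidelity (E : κ → Matrix (Fin q) (Fin q) ℂ) (n : ℕ) (i : Fin n) :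
    Integrable (resetFidelity E n i) (haarGates q n) := by
  refine (integrable_of_continuous_compactSpace (X := Fin (n - 1) → TwoQuditUnitary q) ?_)
  have h := Complex.continuous_re.comp (continuous_trace_mul_noisyRunLin_circuit E i
    (onSite i (ketBraZero q)) (initialState q n))
  simp only [noisyRunLin_apply] at h
  exact h

theorem averagedFidelity_zero (hq : 2 ≤ q) {E : κ → Matrix (Fin q) (Fin q) ℂ}
    (hE : ∑ k, (E k)ᴴ * E k = 1) (m : ℕ) :
    averagedFidelity E (m + 2) 0 = identityWeight E m + (1 - identityWeight E m) / q := by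
  rw [averagedFidelity_eq_re_integral (m := m + 1), integral_readout_zero hq hE]
  exact_mod_cast Complex.ofReal_re (identityWeight E m + (1 - identityWeight E m) / q)

theorem averagedFidelity_of_pos (hq : 2 ≤ q) {E : κ → Matrix (Fin q) (Fin q) ℂ}
    (hE : ∑ k, (E k)ᴴ * E k = 1) (m i : ℕ) (hi : 1 ≤ i) (him : i ≤ m + 1) :
    averagedFidelity E (m + 3) ⟨i, by omega⟩ =
      identityWeight E (m + 2 - i) + (1 - identityWeight E (m + 2 - i)) / q := by
  rw [averagedFidelity_eq_re_integral (m := m + 2), integral_readout_of_pos hq hE m i hi him,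
    trace_ketBraZero, one_mul]
  exact_mod_cast Complex.ofReal_re
    (identityWeight E (m + 2 - i) + (1 - identityWeight E (m + 2 - i)) / q)

end Readout

/-! ### The parameters of the noise -/

section Parameters

variable {κ : Type*} [Fintype κ] {q : ℕ}

/-- Cauchy–Schwarz on the diagonal, whose square sum is at most the full Hilbert–Schmidt norm
squared. -/
theorem norm_trace_sq_le (A : Matrix (Fin q) (Fin q) ℂ) :
    ‖A.trace‖ ^ 2 ≤ q * (Aᴴ * A).trace.re := by
  have h1 : (Aᴴ * A).trace.re = ∑ y, ∑ x, ‖A x y‖ ^ 2 := by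
    simp only [Matrix.trace, Matrix.diag, Matrix.mul_apply, Matrix.conjTranspose_apply,
      Complex.re_sum]
    refine Finset.sum_congr rfl fun y _ => Finset.sum_congr rfl fun x _ => ?_
    rw [← Complex.normSq_eq_norm_sq, Complex.star_def, ← Complex.normSq_eq_conj_mul_self,
      Complex.ofReal_re]
  calc ‖A.trace‖ ^ 2 ≤ (∑ x, ‖A x x‖) ^ 2 := by
        gcongr
        exact norm_sum_le _ _
    _ ≤ q * ∑ x, ‖A x x‖ ^ 2 := by
        simpa using sq_sum_le_card_mul_sum_sq (s := Finset.univ) (f := fun x => ‖A x x‖)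
    _ ≤ q * (Aᴴ * A).trace.re := by
        rw [h1]
        gcongr with y
        exact Finset.single_le_sum (f := fun x => ‖A x y‖ ^ 2) (fun _ _ => by positivity)
          (Finset.mem_univ y)

theorem sum_norm_trace_sq_le {E : κ → Matrix (Fin q) (Fin q) ℂ}
    (hE : ∑ k, (E k)ᴴ * E k = 1) : ∑ k, ‖(E k).trace‖ ^ 2 ≤ (q : ℝ) ^ 2 :=
  calc ∑ k, ‖(E k).trace‖ ^ 2 ≤ ∑ k, q * ((E k)ᴴ * E k).trace.re :=
        Finset.sum_le_sum fun k _ => norm_trace_sq_le (E k)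
    _ = (q : ℝ) ^ 2 := by
        rw [← Finset.mul_sum, ← Complex.re_sum, ← Matrix.trace_sum, hE]
        simp [pow_two]

/-- $\Phi^2$ preserves the trace, so the bound for $\alpha$ also gives $\beta\le1$. -/
theorem sum_conjTranspose_mul_self_prod {E : κ → Matrix (Fin q) (Fin q) ℂ}
    (hE : ∑ k, (E k)ᴴ * E k = 1) :
    ∑ p : κ × κ, (E p.1 * E p.2)ᴴ * (E p.1 * E p.2) = 1 := by
  rw [Fintype.sum_prod_type_right, ← hE]
  refine Finset.sum_congr rfl fun l _ => ?_
  have : ∀ k, (E k * E l)ᴴ * (E k * E l) = (E l)ᴴ * ((E k)ᴴ * E k) * E l := by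
    intro k
    simp only [Matrix.conjTranspose_mul, Matrix.mul_assoc]
  simp only [this]
  rw [← Finset.sum_mul, ← Finset.mul_sum, hE, Matrix.mul_one]

theorem krausAlpha_nonneg (E : κ → Matrix (Fin q) (Fin q) ℂ) : 0 ≤ krausAlpha E := by
  unfold krausAlpha; positivity

theorem krausBeta_nonneg (E : κ → Matrix (Fin q) (Fin q) ℂ) : 0 ≤ krausBeta E := by
  unfold krausBeta; positivity

theorem krausAlpha_le_one {E : κ → Matrix (Fin q) (Fin q) ℂ} (hE : ∑ k, (E k)ᴴ * E k = 1) :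
    krausAlpha E ≤ 1 :=
  div_le_one_of_le₀ (sum_norm_trace_sq_le hE) (by positivity)

theorem krausBeta_le_one {E : κ → Matrix (Fin q) (Fin q) ℂ} (hE : ∑ k, (E k)ᴴ * E k = 1) :
    krausBeta E ≤ 1 := by
  refine div_le_one_of_le₀ ?_ (by positivity)
  have h := sum_norm_trace_sq_le (sum_conjTranspose_mul_self_prod hE)
  rwa [Fintype.sum_prod_type] at h

theorem trace_vecMulVec_mul_mul {ι : Type*} [Fintype ι] (v : ι → ℂ) (A B : Matrix ι ι ℂ) :
    (Matrix.vecMulVec v v * (A * Matrix.vecMulVec v v * B)).trace =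
      (v ⬝ᵥ A *ᵥ v) * (v ⬝ᵥ B *ᵥ v) := by
  rw [Matrix.mul_vecMulVec, Matrix.vecMulVec_mul (A *ᵥ v), Matrix.vecMulVec_mul_vecMulVec,
    Matrix.trace_vecMulVec, dotProduct_smul, smul_eq_mul, dotProduct_comm v (v ᵥ* B),
    Matrix.dotProduct_mulVec v B v]

/-- The projector has rank one, so each Kraus operator contributes $|\langle\varphi|1\otimes
E_k|\varphi\rangle|^2$, and this amplitude is $\mathrm{Tr}\,E_k/q$. -/
theorem krausAlpha_eq_entanglementFidelity (E : κ → Matrix (Fin q) (Fin q) ℂ) :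
    krausAlpha E = entanglementFidelity E := by
  set v : Fin q × Fin q → ℂ := fun x => if x.1 = x.2 then 1 else 0 with hv
  have hP : maxEntangled q = (q : ℂ)⁻¹ • Matrix.vecMulVec v v := by
    ext x y
    simp only [maxEntangled, Matrix.smul_apply, Matrix.vecMulVec_apply, hv, smul_eq_mul, ite_and]
    split_ifs <;> simp
  have hB : ∀ A : Matrix (Fin q) (Fin q) ℂ, v ⬝ᵥ ((1 : Matrix (Fin q) (Fin q) ℂ) ⊗ₖ A) *ᵥ v =
      A.trace := by
    intro A
    simp [dotProduct, Matrix.mulVec, Fintype.sum_prod_type, hv, Matrix.one_apply, Matrix.trace]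
  rw [entanglementFidelity, hP, Finset.mul_sum, Matrix.trace_sum, Complex.re_sum, krausAlpha,
    Finset.sum_div]
  refine Finset.sum_congr rfl fun k _ => ?_
  have h1 : ((1 : Matrix (Fin q) (Fin q) ℂ) ⊗ₖ E k)ᴴ = 1 ⊗ₖ (E k)ᴴ := by
    rw [Matrix.conjTranspose_kronecker, Matrix.conjTranspose_one]
  rw [Matrix.mul_smul, Matrix.smul_mul, Matrix.smul_mul, Matrix.mul_smul, smul_smul,
    Matrix.trace_smul, h1, trace_vecMulVec_mul_mul, hB, hB, Matrix.trace_conjTranspose,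
    Complex.star_def, Complex.mul_conj', smul_eq_mul]
  rw [← mul_inv, div_eq_inv_mul, ← pow_two]
  have : ((q : ℂ) ^ 2)⁻¹ * (‖(E k).trace‖ : ℂ) ^ 2 =
      ((((q : ℝ) ^ 2)⁻¹ * ‖(E k).trace‖ ^ 2 : ℝ) : ℂ) := by push_cast; rfl
  rw [this, Complex.ofReal_re]

end Parameters

/-- With $x=q^2\ge4$, the numerator lies between $-x$ and $x(x-1)$, both strictly inside
$\pm(x^2-1)$. -/
theorem abs_decayRate_lt_one {q α β : ℝ} (hq : 2 ≤ q) (hα0 : 0 ≤ α) (hα1 : α ≤ 1) (hβ0 : 0 ≤ β)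
    (hβ1 : β ≤ 1) : |α * q ^ 2 * (β * q ^ 2 - 1) / (q ^ 4 - 1)| < 1 := by
  have hx : 4 ≤ q ^ 2 := by nlinarith
  have h4 : q ^ 4 = q ^ 2 * q ^ 2 := by ring
  rw [h4]
  generalize q ^ 2 = x at hx
  have hp : 0 < x * x - 1 := by nlinarith
  rw [abs_div, abs_of_pos hp, div_lt_one hp, abs_lt]
  have hαx : 0 ≤ α * x := by positivity
  have hαx1 : α * x ≤ x := by nlinarith
  have hβx : 0 ≤ β * x := by positivity
  have hβx1 : β * x ≤ x := by nlinarith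
  constructor
  · nlinarith [mul_nonneg hαx hβx]
  · nlinarith [mul_nonneg hαx (sub_nonneg.mpr hβx1)]

/-! ### Solution of the recursion, exact values and limits. -/

theorem mainTheorem8 {κ : Type*} [Fintype κ] (q : ℕ) [NeZero q] (hq : 2 ≤ q)
    (E : κ → Matrix (Fin q) (Fin q) ℂ) (hE : ∑ k, (E k)ᴴ * E k = 1)
    (α β D L lam : ℝ) (hα : α = krausAlpha E) (hβ : β = krausBeta E)
    (hD : D = (1 - α * β) * (q : ℝ) ^ 4 + α * (q : ℝ) ^ 2 - 1)
    (hL : L = ((1 - α * β) * (q : ℝ) ^ 3 + α * (q : ℝ) ^ 2 - 1) / D)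
    (hlam : lam = α * (q : ℝ) ^ 2 * (β * (q : ℝ) ^ 2 - 1) / ((q : ℝ) ^ 4 - 1)) :
    α = entanglementFidelity E ∧ 0 < D ∧ |lam| < 1 ∧
    -- the averages are averages of integrable functions
    (∀ (n : ℕ) (i : Fin n), Integrable (resetFidelity E n i) (haarGates q n)) ∧
    -- exact value for the first qudit
    (∀ (n : ℕ) (_ : 2 ≤ n),
      averagedFidelity E n ⟨0, by omega⟩ =
        ((1 - α * β) * (q : ℝ) ^ 3 + (α * (q : ℝ) ^ 2 - 1) *
          (1 - ((q : ℝ) - 1) / q * lam ^ (n - 2))) / D) ∧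
    -- exact value for the `i`-th qudit, `1 < i < n`
    (∀ (n i : ℕ) (_ : 1 < i) (_ : i < n),
      averagedFidelity E n ⟨i - 1, by omega⟩ =
        L - α * q * (α * (q : ℝ) ^ 2 - 1) * (β * (q : ℝ) ^ 2 - 1) /
          ((1 + (q : ℝ)) * (1 + (q : ℝ) ^ 2) * D) * lam ^ (n - i - 1)) ∧
    -- limit for many qudits, geometric convergence with ratio `lam`, and the supremum
    (∀ (i : ℕ) (_ : 1 ≤ i),
      Tendsto (fun m : ℕ => averagedFidelity E (i + 1 + m) ⟨i - 1, by omega⟩) atTop (𝓝 L) ∧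
      (∀ (n : ℕ) (_ : i < n),
        averagedFidelity E (n + 1) ⟨i - 1, by omega⟩ - L =
          lam * (averagedFidelity E n ⟨i - 1, by omega⟩ - L)) ∧
      (1 ≤ α * (q : ℝ) ^ 2 → 1 ≤ β * (q : ℝ) ^ 2 →
        IsLUB (Set.range fun m : ℕ => averagedFidelity E (i + 1 + m) ⟨i - 1, by omega⟩) L)) := by
  have hq2 : (2 : ℝ) ≤ q := by exact_mod_cast hq
  have hq0 : (q : ℝ) ≠ 0 := by positivity
  have hq4 : 0 < (q : ℝ) ^ 4 - 1 := by
    have : (2 : ℝ) ^ 4 ≤ (q : ℝ) ^ 4 := by gcongr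
    linarith
  have hlam1 : |lam| < 1 := by
    rw [hlam]
    exact abs_decayRate_lt_one hq2 (hα ▸ krausAlpha_nonneg E) (hα ▸ krausAlpha_le_one hE)
      (hβ ▸ krausBeta_nonneg E) (hβ ▸ krausBeta_le_one hE)
  -- Positivity of $D$ is thereby the same as $\lambda<1$.
  have hDlam : D = ((q : ℝ) ^ 4 - 1) * (1 - lam) := by
    rw [hD, hlam]
    field_simp
    ring
  have hDpos : 0 < D := by
    rw [hDlam]
    exact mul_pos hq4 (by linarith [(abs_lt.mp hlam1).2])
  have hw : ∀ m, identityWeight E m = (α * (q : ℝ) ^ 2 - 1) / D * (1 - lam ^ m) := by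
    intro m
    induction m with
    | zero => simp [identityWeight]
    | succ m ih =>
      have h1 : identityWeight E (m + 1) =
          lam * identityWeight E m + (α * (q : ℝ) ^ 2 - 1) / ((q : ℝ) ^ 4 - 1) := by
        rw [identityWeight, hlam, ← hα, ← hβ]
        field_simp
        ring
      have h2 : 1 - lam ≠ 0 := by linarith [(abs_lt.mp hlam1).2]
      rw [h1, ih, hDlam]
      field_simp
      ring
  -- the fidelity in terms of the number of gates after the last one on the qudit
  have hF : ∀ m, identityWeight E m + (1 - identityWeight E m) / q =
      L - (α * (q : ℝ) ^ 2 - 1) * ((q : ℝ) - 1) / (q * D) * lam ^ m := by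
    intro m
    rw [hw, hL]
    field_simp
    rw [hD]
    ring
  have hfirst : ∀ n (hn : 2 ≤ n), averagedFidelity E n ⟨0, by omega⟩ =
      L - (α * (q : ℝ) ^ 2 - 1) * ((q : ℝ) - 1) / (q * D) * lam ^ (n - 2) := by
    intro n hn
    obtain ⟨m, rfl⟩ := Nat.exists_eq_add_of_le' hn
    rw [← hF]
    exact averagedFidelity_zero hq hE m
  have hlater : ∀ n i (h1 : 1 < i) (h2 : i < n), averagedFidelity E n ⟨i - 1, by omega⟩ =
      L - (α * (q : ℝ) ^ 2 - 1) * ((q : ℝ) - 1) / (q * D) * lam ^ (n - i) := by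
    intro n i h1 h2
    obtain ⟨m, rfl⟩ := Nat.exists_eq_add_of_le' (show 3 ≤ n by omega)
    rw [← hF, averagedFidelity_of_pos hq hE m (i - 1) (by omega) (by omega),
      show m + 2 - (i - 1) = m + 3 - i by omega]
  -- The shift is $s=\max(i,2)$, as qudits 1 and 2 share the exponent $n-2$. The bound $s\le i+1\le
  -- n$ keeps the natural subtraction exact.
  have hall : ∀ i, 1 ≤ i → ∃ s : ℕ, s ≤ i + 1 ∧ ∀ n (h : i < n),
      averagedFidelity E n ⟨i - 1, by omega⟩ =
        L - (α * (q : ℝ) ^ 2 - 1) * ((q : ℝ) - 1) / (q * D) * lam ^ (n - s) := by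
    intro i hi
    obtain rfl | h1 : i = 1 ∨ 1 < i := by omega
    · exact ⟨2, le_rfl, fun n h => hfirst n h⟩
    · exact ⟨i, by omega, fun n h => hlater n i h1 h⟩
  refine ⟨hα ▸ krausAlpha_eq_entanglementFidelity E, hDpos, hlam1, integrable_resetFidelity E,
    fun n hn => ?_, fun n i h1 h2 => ?_, fun i hi => ?_⟩
  · rw [hfirst n hn, hL]
    field_simp
    ring
  · have e : (q : ℝ) ^ 4 - 1 = ((q : ℝ) - 1) * ((1 + q) * (1 + (q : ℝ) ^ 2)) := by ring
    have hq1 : (q : ℝ) - 1 ≠ 0 := by linarith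
    -- One factor $\lambda$ is absorbed into the constant, which lowers the exponent to $n-i-1$; the
    -- factor $q-1$ cancels against $q^4-1$.
    have hc : (α * (q : ℝ) ^ 2 - 1) * ((q : ℝ) - 1) / (q * D) * lam =
        α * q * (α * (q : ℝ) ^ 2 - 1) * (β * (q : ℝ) ^ 2 - 1) /
          ((1 + (q : ℝ)) * (1 + (q : ℝ) ^ 2) * D) := by
      rw [hlam, e]
      field_simp
    have hp : lam ^ (n - i) = lam * lam ^ (n - i - 1) := by
      rw [← pow_succ']
      congr 1
      omega
    rw [hlater n i h1 h2, hp, ← hc]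
    ring
  · obtain ⟨s, hs, hall⟩ := hall i hi
    have hlim : Tendsto (fun m : ℕ => averagedFidelity E (i + 1 + m) ⟨i - 1, by omega⟩) atTop
        (𝓝 L) := by
      have h1 : Tendsto (fun m : ℕ => lam ^ (m + (i + 1 - s))) atTop (𝓝 0) :=
        (tendsto_pow_atTop_nhds_zero_of_abs_lt_one hlam1).comp (tendsto_add_atTop_nat _)
      have h2 := (h1.const_mul
        ((α * (q : ℝ) ^ 2 - 1) * ((q : ℝ) - 1) / (q * D))).const_sub L
      rw [mul_zero, sub_zero] at h2
      refine h2.congr fun m => ?_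
      rw [hall (i + 1 + m) (by omega), show m + (i + 1 - s) = i + 1 + m - s by omega]
    refine ⟨hlim, fun n hn => ?_, fun hα1 hβ1 => ⟨?_, fun b hb => ?_⟩⟩
    · rw [hall (n + 1) (by omega), hall n hn, show n + 1 - s = n - s + 1 by omega, pow_succ]
      ring
    · rintro _ ⟨m, rfl⟩
      change averagedFidelity E (i + 1 + m) ⟨i - 1, _⟩ ≤ L
      rw [hall (i + 1 + m) (by omega)]
      -- Under the two extra assumptions the deviation from the limit has a constant sign, so the
      -- limit is an upper bound and hence the supremum.
      have hlam0 : 0 ≤ lam := by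
        rw [hlam]
        refine div_nonneg (mul_nonneg (by linarith) (by linarith)) hq4.le
      have h1 : 0 ≤ (α * (q : ℝ) ^ 2 - 1) * ((q : ℝ) - 1) / (q * D) :=
        div_nonneg (mul_nonneg (by linarith) (by linarith)) (by positivity)
      have := mul_nonneg h1 (pow_nonneg hlam0 (i + 1 + m - s))
      linarith
    · exact le_of_tendsto' hlim fun m => hb ⟨m, rfl⟩
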